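/- **Theorem 3.7 (forcing properties).** Let $L$ be the first-order language with constants $0,1$, unary functions $\lfloor x/2\rfloor$ and $|x|$ (bit length), binary functions $x+y$, $x\cdot y$, $x\#y$ (on $\mathbb N$: $2^{|x|\cdot|y|}$) and the binary relation $x<y$, and let $L(R)$ be $L$ with an additional binary relation symbol $R$. Let $\mathbb M$ be a countable model of $Th(\mathbb N)$ in the language $L$ and let $n\in\mathbb M$ be non-standard; write $[m]=\{x\in\mathbb M : x<m\}$. Let $\mathbb I$ be the substructure of $\mathbb M$ with domain $\{m : m<2^{|n|^c}\text{ for some standard }c\}$. $L(R)$-formulas may contain parameters from $\mathbb I$. An $L(R)$-formula is *sharply bounded* if it is built from atomic formulas by connectives and quantifiers $\forall x<|t|$, $\exists x<|t|$, where $t$ is a term not containing $x$. Let $\mathbb P$ be the set of all partial injective functions from $[n+1]$ to $[n]$ that are (coded) in $\mathbb M$ and have size at most $|n|^c$ for some standard $c$; its elements are called conditions, and $\tau\le\sigma$ means $\tau\supseteq\sigma$. Conditions $\sigma,\tau$ are *compatible* if some $\delta\in\mathbb P$ satisfies $\delta\le\sigma$ and $\delta\le\tau$; otherwise $\sigma\perp\tau$.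 A set $D\subseteq\mathbb P$ is *dense* if every $\sigma\in\mathbb P$ has some $\tau\in D$ with $\tau\le\sigma$, and *$\mathbb P$-definable* if it is definable with parameters in $(\mathbb M,\mathbb P)$. A *filter* is a set $G\subseteq\mathbb P$ of pairwise compatible conditions such that $\sigma\in G$, $\sigma\le\tau\in\mathbb P$ imply $\tau\in G$; it is *generic* if it meets every dense $\mathbb P$-definable set. Put $R_G=\bigcup G$. For $\sigma\in\mathbb P$ and an $L(R)$-sentence $\phi$, $\sigma\Vdash\phi$ means that $(\mathbb I,R_G)\vDash\phi$ for every generic filter $G$ containing $\sigma$. Then for every $\sigma\in\mathbb P$: 1. for $a\in[n+1]$ and $b\in[n]$: $\sigma\Vdash R(a,b)$ iff $\{(a,b)\}\subseteq\sigma$; 2. for $a\in[n+1]$ and $b\in[n]$: $\sigma\Vdash\neg R(a,b)$ iff $\{(a,b)\}\perp\sigma$; 3. for any $L(R)$-sentences $\phi,\theta$: $\sigma\Vdash\phi\land\theta$ iff $\sigma\Vdash\phi$ and $\sigma\Vdash\theta$; 4. for any $L(R)$-formula $\phi(x)$: $\sigma\Vdash\forall x\,\phi(x)$ iff $\sigma\Vdash\phi(a)$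 for all $a\in\mathbb I$; 5. for any sharply bounded $L(R)$-sentence $\phi$: $\sigma\Vdash\neg\phi$ iff $\tau\nVdash\phi$ for all $\tau\le\sigma$; 6. for any sharply bounded $L(R)$-sentences $\phi,\theta$: $\sigma\Vdash\phi\lor\theta$ iff for every $\tau\le\sigma$ there is $\rho\le\tau$ such that $\rho\Vdash\phi$ or $\rho\Vdash\theta$; 7. for any sharply bounded $L(R)$-formula $\phi(\overline x)$: $\sigma\Vdash\exists\overline x\,\phi(\overline x)$ iff for every $\tau\le\sigma$ there are $\rho\le\tau$ and a tuple $\overline a$ from $\mathbb I$ such that $\rho\Vdash\phi(\overline a)$. -/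

import Mathlib

universe u

open FirstOrder Language Structure

namespace BoundedArith

/-! ## The language of bounded arithmetic and its standard model -/

/-- Function symbols: `0`, `1`, `⌊x/2⌋`, `|x|`, `x + y`, `x · y`, `x # y`. -/
inductive ArithFunc : ℕ → Type
  | zero : ArithFunc 0
  | one : ArithFunc 0
  | half : ArithFunc 1
  | len : ArithFunc 1
  | add : ArithFunc 2
  | mul : ArithFunc 2
  | smash : ArithFunc 2

/-- The only non-logical relation symbol is `x < y`. -/
inductive ArithRel : ℕ → Type
  | lt : ArithRel 2

/-- The language `L`. -/
abbrev arith : Language := ⟨ArithFunc, ArithRel⟩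

/-- The standard model `ℕ`; `|x|` is the bit length and `x # y = 2 ^ (|x| * |y|)`. -/
instance natStructure : arith.Structure ℕ where
  funMap {_} f := match f with
    | .zero => fun _ => 0
    | .one => fun _ => 1
    | .half => fun v => v 0 / 2
    | .len => fun v => Nat.size (v 0)
    | .add => fun v => v 0 + v 1
    | .mul => fun v => v 0 * v 1
    | .smash => fun v => 2 ^ (Nat.size (v 0) * Nat.size (v 1))
  RelMap {_} r := match r with
    | .lt => fun v => v 0 < v 1

/-! ## Arithmetic inside a model -/

section Model

variable {M : Type u} [arith.Structure M]

/-- Interpretations in `M` of the symbols of `L`. -/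
def mzero : M := funMap (L := arith) ArithFunc.zero ![]
def mone : M := funMap (L := arith) ArithFunc.one ![]
def mhalf (x : M) : M := funMap (L := arith) ArithFunc.half ![x]
def mlen (x : M) : M := funMap (L := arith) ArithFunc.len ![x]
def madd (x y : M) : M := funMap (L := arith) ArithFunc.add ![x, y]
def mmul (x y : M) : M := funMap (L := arith) ArithFunc.mul ![x, y]
def msmash (x y : M) : M := funMap (L := arith) ArithFunc.smash ![x, y]
def mlt (x y : M) : Prop := RelMap (L := arith) ArithRel.lt ![x, y]

/-- The element of `M` named by the standard number `k`. -/
def numeral : ℕ → M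
  | 0 => mzero
  | k + 1 => madd (numeral k) mone

/-- `x` is a non-standard number of `M`. -/
def Nonstandard (x : M) : Prop := ∀ k : ℕ, x ≠ numeral k

/-- The power `x ^ c` for a standard exponent `c`. -/
def mpow (x : M) : ℕ → M
  | 0 => mone
  | c + 1 => mmul x (mpow x c)

/-- `p = 2 ^ e` in the sense of `M`: `p = w # 1` for some `w` of bit length `e`. -/
def IsTwoPow (e p : M) : Prop := ∃ w, mlen w = e ∧ p = msmash w mone

/-- The numbers of `M` below `2 ^ (|n| ^ c)` for some standard `c`. -/
def cutSet (n : M) : Set M :=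
  {m | ∃ c : ℕ, ∃ p, IsTwoPow (mpow (mlen n) c) p ∧ mlt m p}

/-- Ordered pairs, coded by the term `(a + b) * (a + b) + a`. -/
def mpair (a b : M) : M := madd (mmul (madd a b) (madd a b)) a

/-- Membership in the set coded by `s` (binary coding of finite sets): the bit of `s` of
weight `2 ^ x` is `1`. Different elements of `M` code different sets. -/
def mmem (x s : M) : Prop :=
  ∃ p q r, IsTwoPow x p ∧ s = madd (madd (mmul q (madd p p)) p) r ∧ mlt r p

/-- The set coded by `s` has, in the sense of `M`, at most `k` elements: there is in `M` an
injective map from it to the set of numbers below `k`. -/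
def CardLE (s k : M) : Prop :=
  ∃ f : M, (∀ x, mmem x s → ∃ y, mlt y k ∧ mmem (mpair x y) f) ∧
    (∀ x y y', mmem (mpair x y) f → mmem (mpair x y') f → y = y') ∧
    (∀ x x' y, mmem (mpair x y) f → mmem (mpair x' y) f → x = x')

/-! ## Conditions -/

/-- `s` codes a partial injective function between `[n + 1]` and `[n]` of size at most
`|n| ^ c` for some standard `c`. -/
structure IsCondition (n s : M) : Prop where
  sub : ∀ z, mmem z s → ∃ a b, z = mpair a b ∧ mlt a (madd n mone) ∧ mlt b n
  functional : ∀ a b b', mmem (mpair a b) s → mmem (mpair a b') s → b = b'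
  injective : ∀ a a' b, mmem (mpair a b) s → mmem (mpair a' b) s → a = a'
  size : ∃ c : ℕ, CardLE s (mpow (mlen n) c)

/-- The set `ℙ` of conditions. -/
def Cond (n : M) : Type u := {s : M // IsCondition n s}

variable {n : M}

/-- `σ.Has a b` says `(a, b) ∈ σ`. -/
def Cond.Has (σ : Cond n) (a b : M) : Prop := mmem (mpair a b) σ.1

/-- `σ ≤ ρ` means `σ ⊇ ρ`. -/
instance : LE (Cond n) := ⟨fun σ ρ => ∀ a b, ρ.Has a b → σ.Has a b⟩

/-- Two conditions are compatible when they have a common extension. -/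
def Compatible (σ τ : Cond n) : Prop := ∃ δ : Cond n, δ ≤ σ ∧ δ ≤ τ

def Incompatible (σ τ : Cond n) : Prop := ¬ Compatible σ τ

/-- The one unary predicate symbol of the expansion `(M, ℙ)`. -/
inductive CondRel : ℕ → Type
  | P : CondRel 1

abbrev condLang : Language := ⟨fun _ => Empty, CondRel⟩

/-- The expansion `(M, ℙ)` of `M` by a predicate for the set of conditions. -/
@[reducible] def expansion (n : M) : (arith.sum condLang).Structure M :=
  letI : condLang.Structure M :=
    { funMap := fun f => nomatch f
      RelMap := fun {_} r => match r with
        | .P => fun v => IsCondition n (v 0) }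
  inferInstance

/-- A set of conditions is `ℙ`-definable when it is definable, with parameters, in `(M, ℙ)`. -/
def CondDefinable (D : Set (Cond n)) : Prop :=
  letI := expansion n
  (Set.univ : Set M).Definable₁ (arith.sum condLang) (Subtype.val '' D)

def IsDenseSet (D : Set (Cond n)) : Prop := ∀ σ : Cond n, ∃ τ ∈ D, τ ≤ σ

structure IsFilter (G : Set (Cond n)) : Prop where
  compatible : ∀ σ ∈ G, ∀ τ ∈ G, Compatible σ τ
  upward : ∀ σ ∈ G, ∀ τ : Cond n, σ ≤ τ → τ ∈ G

structure IsGeneric (G : Set (Cond n)) : Prop where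
  filter : IsFilter G
  meets : ∀ D : Set (Cond n), IsDenseSet D → CondDefinable D → (G ∩ D).Nonempty

/-- The relation `R_G`, the union of `G`. -/
def genericRel (G : Set (Cond n)) (a b : M) : Prop := ∃ σ ∈ G, σ.Has a b

end Model

/-! ## Transfer of universal sentences from `ℕ`, used below to see that the cut is a
substructure and that singletons are conditions -/

section Transfer

variable {α : Type}

def tzero : arith.Term α := Constants.term (L := arith) ArithFunc.zero
def tone : arith.Term α := Constants.term (L := arith) ArithFunc.one
def thalf (t : arith.Term α) : arith.Term α := Functions.apply₁ (L := arith) ArithFunc.half t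
def tlen (t : arith.Term α) : arith.Term α := Functions.apply₁ (L := arith) ArithFunc.len t
def tadd (t u : arith.Term α) : arith.Term α := Functions.apply₂ (L := arith) ArithFunc.add t u
def tmul (t u : arith.Term α) : arith.Term α := Functions.apply₂ (L := arith) ArithFunc.mul t u
def tsmash (t u : arith.Term α) : arith.Term α :=
  Functions.apply₂ (L := arith) ArithFunc.smash t u
def tlt {k : ℕ} (t u : arith.Term (Empty ⊕ Fin k)) : arith.BoundedFormula Empty k :=
  Relations.boundedFormula₂ (L := arith) ArithRel.lt t u

section

variable {M : Type u} [arith.Structure M]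

theorem realize_tzero (v : α → M) : (tzero : arith.Term α).realize v = mzero := by
  simp only [tzero, mzero, Constants.term, Term.realize]
  congr 1; exact Subsingleton.elim _ _
theorem realize_tone (v : α → M) : (tone : arith.Term α).realize v = mone := by
  simp only [tone, mone, Constants.term, Term.realize]
  congr 1; exact Subsingleton.elim _ _
theorem realize_thalf (v : α → M) (t : arith.Term α) :
    (thalf t).realize v = mhalf (t.realize v) := Term.realize_functions_apply₁
theorem realize_tlen (v : α → M) (t : arith.Term α) :
    (tlen t).realize v = mlen (t.realize v) := Term.realize_functions_apply₁
theorem realize_tadd (v : α → M) (t u : arith.Term α) :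
    (tadd t u).realize v = madd (t.realize v) (u.realize v) := Term.realize_functions_apply₂
theorem realize_tmul (v : α → M) (t u : arith.Term α) :
    (tmul t u).realize v = mmul (t.realize v) (u.realize v) := Term.realize_functions_apply₂
theorem realize_tsmash (v : α → M) (t u : arith.Term α) :
    (tsmash t u).realize v = msmash (t.realize v) (u.realize v) := Term.realize_functions_apply₂
theorem realize_tlt {k : ℕ} (v : Empty → M) (xs : Fin k → M) (t u : arith.Term (Empty ⊕ Fin k)) :
    (tlt t u).Realize v xs ↔ mlt (t.realize (Sum.elim v xs)) (u.realize (Sum.elim v xs)) :=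
  BoundedFormula.realize_rel₂

end

theorem nat_zero : (mzero : ℕ) = 0 := rfl
theorem nat_one : (mone : ℕ) = 1 := rfl
theorem nat_half (x : ℕ) : mhalf x = x / 2 := rfl
theorem nat_len (x : ℕ) : mlen x = Nat.size x := rfl
theorem nat_add (x y : ℕ) : madd x y = x + y := rfl
theorem nat_mul (x y : ℕ) : mmul x y = x * y := rfl
theorem nat_smash (x y : ℕ) : msmash x y = 2 ^ (Nat.size x * Nat.size y) := rfl
theorem nat_lt (x y : ℕ) : mlt x y ↔ x < y := Iff.rfl

variable {M : Type u} [arith.Structure M] [M ⊨ arith.completeTheory ℕ]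

theorem transfer {k : ℕ} (φ : arith.BoundedFormula Empty k)
    (h : ∀ (v : Empty → ℕ) (xs : Fin k → ℕ), φ.Realize v xs) (v : Empty → M) (xs : Fin k → M) :
    φ.Realize v xs := by
  have h0 : ℕ ⊨ φ.alls := BoundedFormula.realize_alls.2 (h _)
  have h1 : M ⊨ φ.alls := Theory.realize_sentence_of_mem (arith.completeTheory ℕ) h0
  rw [Subsingleton.elim v default]
  exact BoundedFormula.realize_alls.1 h1 xs

attribute [local simp] realize_tzero realize_tone realize_thalf realize_tlen realize_tadd
  realize_tmul realize_tsmash realize_tlt nat_zero nat_one nat_half nat_len nat_add nat_mul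
  nat_smash nat_lt Fin.snoc

theorem exists_len_eq (i : M) : ∃ w : M, mlen w = i := by
  have := transfer (M := M) (k := 1) (∃' (tlen (&1) =' (&0)))
    (by
      intro v xs
      simp
      rcases Nat.eq_zero_or_pos (xs 0) with h | h
      · exact ⟨0, by simp [h]⟩
      · refine ⟨2 ^ (xs 0 - 1), ?_⟩
        rw [Nat.size_pow]; omega) Empty.elim ![i]
  simpa using this

theorem zero_one_or (x : M) : x = mzero ∨ x = madd mzero mone ∨ mlt mone x := by
  have := transfer (M := M) (k := 1)
    (((&0) =' tzero) ⊔ ((((&0) =' (tadd tzero tone))) ⊔ tlt tone (&0)))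
    (by intro v xs; simp; omega) Empty.elim ![x]
  simpa using this

theorem mone_mul (x : M) : mmul mone x = x := by
  have := transfer (M := M) (k := 1) (tmul tone (&0) =' (&0))
    (by intro v xs; simp) Empty.elim ![x]
  simpa using this

theorem mmul_assoc (x y z : M) : mmul (mmul x y) z = mmul x (mmul y z) := by
  have := transfer (M := M) (k := 3) (tmul (tmul (&0) (&1)) (&2) =' tmul (&0) (tmul (&1) (&2)))
    (by intro v xs; simp [mul_assoc]) Empty.elim ![x, y, z]
  simpa using this

theorem zero_lt_mone : mlt (mzero : M) mone := by
  have := transfer (M := M) (k := 0) (tlt tzero tone) (by intro v xs; simp) Empty.elim ![]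
  simpa using this

theorem len_mul_pos (m k : M) (hm : mlt mone m) (hk : mlt mzero k) :
    mlt mzero (mmul (mlen m) k) := by
  have := transfer (M := M) (k := 2)
    (tlt tone (&0) ⟹ (tlt tzero (&1) ⟹ tlt tzero (tmul (tlen (&0)) (&1))))
    (by
      intro v xs
      simp
      intro h1 h2
      exact ⟨Nat.size_pos.2 (by omega), h2⟩) Empty.elim ![m, k]
  simp at this
  exact this hm hk

theorem constants_lt (z : M) (hz : mlen z = mone) :
    mlt mzero (msmash z mone) ∧ mlt mone (msmash z mone) := by
  have := transfer (M := M) (k := 1)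
    ((tlen (&0) =' tone) ⟹ (tlt tzero (tsmash (&0) tone) ⊓ tlt tone (tsmash (&0) tone)))
    (by
      intro v xs
      simp
      intro h
      simp [h]) Empty.elim ![z]
  simp at this
  exact this hz

theorem lt_bound (m x z : M) (hm : mlt mone m) (hx : mlt x (madd m mone))
    (hz : mlen z = mmul (mlen m) mone) : mlt x (msmash z mone) := by
  have := transfer (M := M) (k := 3)
    (tlt tone (&0) ⟹ (tlt (&1) (tadd (&0) tone) ⟹
      ((tlen (&2) =' tmul (tlen (&0)) tone) ⟹ tlt (&1) (tsmash (&2) tone))))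
    (by
      intro v xs
      simp
      intro h1 h2 h3
      have := Nat.lt_size_self (xs 0)
      rw [h3]
      omega) Empty.elim ![m, x, z]
  simp at this
  exact this hm hx hz

theorem nat_closure (m x y s t : ℕ) (hm : 1 < m) (hs : 0 < s) (ht : 0 < t)
    (hx : x < 2 ^ s) (hy : y < 2 ^ t) :
    x / 2 < 2 ^ (m.size * (s * t)) ∧ x.size < 2 ^ (m.size * (s * t)) ∧
    x + y < 2 ^ (m.size * (s * t)) ∧ x * y < 2 ^ (m.size * (s * t)) ∧
    2 ^ (x.size * y.size) < 2 ^ (m.size * (s * t)) := by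
  have h2 : 2 ≤ m.size := Nat.lt_size.2 (by rw [pow_one]; exact hm)
  have hst : 1 ≤ s * t := Nat.mul_pos hs ht
  have hs' : s ≤ s * t := Nat.le_mul_of_pos_right _ ht
  have ht' : t ≤ s * t := Nat.le_mul_of_pos_left _ hs
  have hle : s * t + s * t ≤ m.size * (s * t) := by nlinarith
  have hx' := hx.trans_le (Nat.pow_le_pow_right (n := 2) (by norm_num) hs')
  have hy' := hy.trans_le (Nat.pow_le_pow_right (n := 2) (by norm_num) ht')
  have hp := Nat.pow_le_pow_right (n := 2) (by norm_num) hle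
  have hxs : x.size ≤ s := Nat.size_le.2 hx
  have hys : y.size ≤ t := Nat.size_le.2 hy
  have hpos : 2 ≤ 2 ^ (s * t) := by
    calc 2 = 2 ^ 1 := rfl
      _ ≤ 2 ^ (s * t) := Nat.pow_le_pow_right (by norm_num) hst
  rw [pow_add] at hp
  have hs2 : s < 2 ^ s := Nat.lt_two_pow_self
  have hs3 : 2 ^ s ≤ 2 ^ (s * t) := Nat.pow_le_pow_right (by norm_num) hs'
  refine ⟨?_, ?_, ?_, ?_, ?_⟩
  · have := Nat.div_le_self x 2
    nlinarith
  · nlinarith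
  · nlinarith
  · exact (Nat.mul_lt_mul'' hx' hy').trans_le hp
  · refine Nat.pow_lt_pow_right (by norm_num) ?_
    have := Nat.mul_le_mul hxs hys
    omega

theorem closure_lt (m x y s t z : M) (hm : mlt mone m) (hs : mlt mzero (mlen s))
    (ht : mlt mzero (mlen t)) (hx : mlt x (msmash s mone)) (hy : mlt y (msmash t mone))
    (hz : mlen z = mmul (mlen m) (mmul (mlen s) (mlen t))) :
    mlt (mhalf x) (msmash z mone) ∧ mlt (mlen x) (msmash z mone) ∧
    mlt (madd x y) (msmash z mone) ∧ mlt (mmul x y) (msmash z mone) ∧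
    mlt (msmash x y) (msmash z mone) := by
  have := transfer (M := M) (k := 6)
    (tlt tone (&0) ⟹ (tlt tzero (tlen (&3)) ⟹ (tlt tzero (tlen (&4)) ⟹
      (tlt (&1) (tsmash (&3) tone) ⟹ (tlt (&2) (tsmash (&4) tone) ⟹
      ((tlen (&5) =' tmul (tlen (&0)) (tmul (tlen (&3)) (tlen (&4)))) ⟹
        (tlt (thalf (&1)) (tsmash (&5) tone) ⊓ (tlt (tlen (&1)) (tsmash (&5) tone) ⊓
        (tlt (tadd (&1) (&2)) (tsmash (&5) tone) ⊓ (tlt (tmul (&1) (&2)) (tsmash (&5) tone) ⊓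
        tlt (tsmash (&1) (&2)) (tsmash (&5) tone)))))))))))
    (by
      intro v xs
      simp only [BoundedFormula.realize_imp, BoundedFormula.realize_inf,
        BoundedFormula.realize_bdEqual, realize_tlt, realize_tone, realize_tzero, realize_tlen,
        realize_tmul, realize_tadd, realize_thalf, realize_tsmash, nat_zero, nat_one, nat_half,
        nat_len, nat_add, nat_mul, nat_smash, nat_lt, Nat.size_one, mul_one]
      intro h1 h2 h3 h4 h5 h6
      rw [h6]
      exact nat_closure _ _ _ _ _ h1 h2 h3 h4 h5) Empty.elim ![m, x, y, s, t, z]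
  simp at this
  exact this hm hs ht hx hy hz

theorem mpair_inj {a b c d : M} (h : mpair a b = mpair c d) : a = c ∧ b = d := by
  have := transfer (M := M) (k := 4)
    ((tadd (tmul (tadd (&0) (&1)) (tadd (&0) (&1))) (&0) ='
      tadd (tmul (tadd (&2) (&3)) (tadd (&2) (&3))) (&2)) ⟹
        (((&0) =' (&2)) ⊓ ((&1) =' (&3))))
    (by
      intro v xs
      simp
      intro h
      have h1 : xs 0 + xs 1 = xs 2 + xs 3 := by
        by_contra hne
        rcases Nat.lt_or_gt_of_ne hne with h' | h' <;> nlinarith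
      rw [h1] at h
      omega) Empty.elim ![a, b, c, d]
  simp at this
  exact this h

/-- For `w` of bit length `i` the number `w # 1 = 2 ^ i` codes the set `{i}`. -/
theorem mmem_singleton (w y : M) : mmem y (msmash w mone) ↔ y = mlen w := by
  constructor
  · rintro ⟨p, q, r, ⟨u, rfl, rfl⟩, h, hr⟩
    have := transfer (M := M) (k := 4)
      ((tsmash (&0) tone =' tadd (tadd (tmul (&2) (tadd (tsmash (&1) tone) (tsmash (&1) tone)))
        (tsmash (&1) tone)) (&3)) ⟹ (tlt (&3) (tsmash (&1) tone) ⟹ (tlen (&1) =' tlen (&0))))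
      (by
        intro v xs
        simp
        generalize (xs 0).size = i
        generalize (xs 1).size = j
        intro h hr
        have h1 : (2 ^ i).testBit j = true := by
          rw [h, Nat.testBit_eq_decide_div_mod_eq]
          have : (xs 2 * (2 ^ j + 2 ^ j) + 2 ^ j + xs 3) / 2 ^ j = 2 * xs 2 + 1 := by
            rw [Nat.div_eq_iff (by positivity)]
            have := Nat.two_pow_pos j
            constructor
            · nlinarith
            · have e : (2 * xs 2 + 1) * 2 ^ j = xs 2 * (2 ^ j + 2 ^ j) + 2 ^ j := by ring
              omega
          rw [this]; simp
        rw [Nat.testBit_two_pow] at h1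
        simpa [eq_comm] using h1) Empty.elim ![w, u, q, r]
    simp at this
    exact this h hr
  · rintro rfl
    refine ⟨msmash w mone, mzero, mzero, ⟨w, rfl, rfl⟩, ?_⟩
    have := transfer (M := M) (k := 1)
      ((tsmash (&0) tone =' tadd (tadd (tmul tzero (tadd (tsmash (&0) tone) (tsmash (&0) tone)))
        (tsmash (&0) tone)) tzero) ⊓ tlt tzero (tsmash (&0) tone))
      (by intro v xs; simp) Empty.elim ![w]
    simpa using this

end Transfer

section Cut

variable {M : Type u} [arith.Structure M] [M ⊨ arith.completeTheory ℕ] {n : M}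

theorem Nonstandard.one_lt (hn : Nonstandard n) : mlt mone n := by
  rcases zero_one_or n with h | h | h
  · exact absurd h (hn 0)
  · exact absurd h (hn 1)
  · exact h

theorem mpow_pos (hn : Nonstandard n) (c : ℕ) : mlt mzero (mpow (mlen n) c) := by
  induction c with
  | zero => exact zero_lt_mone
  | succ c ih => exact len_mul_pos _ _ hn.one_lt ih

theorem mpow_add (x : M) (c d : ℕ) : mpow x (c + d) = mmul (mpow x c) (mpow x d) := by
  induction c with
  | zero => rw [Nat.zero_add]; exact (mone_mul _).symm
  | succ c ih =>
    rw [Nat.succ_add]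
    change mmul x (mpow x (c + d)) = mmul (mmul x (mpow x c)) (mpow x d)
    rw [ih, mmul_assoc]

theorem cutSet_closed (hn : Nonstandard n) {x y : M} (hx : x ∈ cutSet n) (hy : y ∈ cutSet n) :
    mhalf x ∈ cutSet n ∧ mlen x ∈ cutSet n ∧ madd x y ∈ cutSet n ∧ mmul x y ∈ cutSet n ∧
      msmash x y ∈ cutSet n := by
  obtain ⟨c, p, ⟨s, hs, rfl⟩, hx⟩ := hx
  obtain ⟨d, q, ⟨t, ht, rfl⟩, hy⟩ := hy
  obtain ⟨z, hz⟩ := exists_len_eq (mpow (mlen n) (c + d + 1))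
  have hz' : mlen z = mmul (mlen n) (mmul (mlen s) (mlen t)) := by
    rw [hz, hs, ht, ← mpow_add]; rfl
  have key := closure_lt n x y s t z hn.one_lt (hs ▸ mpow_pos hn c) (ht ▸ mpow_pos hn d) hx hy hz'
  have mem : ∀ {w : M}, mlt w (msmash z mone) → w ∈ cutSet n :=
    fun hw => ⟨c + d + 1, _, ⟨z, hz, rfl⟩, hw⟩
  exact ⟨mem key.1, mem key.2.1, mem key.2.2.1, mem key.2.2.2.1, mem key.2.2.2.2⟩

theorem constants_mem_cutSet (n : M) : mzero ∈ cutSet n ∧ mone ∈ cutSet n := by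
  obtain ⟨z, hz⟩ := exists_len_eq (mone : M)
  have h := constants_lt z hz
  exact ⟨⟨0, _, ⟨z, hz, rfl⟩, h.1⟩, ⟨0, _, ⟨z, hz, rfl⟩, h.2⟩⟩

theorem mem_cutSet_of_lt (hn : Nonstandard n) {x : M} (hx : mlt x (madd n mone)) :
    x ∈ cutSet n := by
  obtain ⟨z, hz⟩ := exists_len_eq (mpow (mlen n) 1)
  exact ⟨1, _, ⟨z, hz, rfl⟩, lt_bound n x z hn.one_lt hx hz⟩

theorem lt_succ_of_lt {x : M} (hx : mlt x n) : mlt x (madd n mone) := by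
  have := transfer (M := M) (k := 2) (tlt (&0) (&1) ⟹ tlt (&0) (tadd (&1) tone))
    (by
      intro v xs
      simp [realize_tlt, realize_tadd, realize_tone, nat_lt, nat_add, nat_one]
      omega) Empty.elim ![x, n]
  simp [realize_tlt, realize_tadd, realize_tone] at this
  exact this hx

/-- The substructure `𝕀` of `M` with domain `cutSet n`. -/
def cut (hn : Nonstandard n) : arith.Substructure M where
  carrier := cutSet n
  fun_mem {k} f := by
    intro v hv
    cases f with
    | zero =>
      have h := (constants_mem_cutSet n).1
      rwa [mzero, Subsingleton.elim ![] v] at h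
    | one =>
      have h := (constants_mem_cutSet n).2
      rwa [mone, Subsingleton.elim ![] v] at h
    | half =>
      have h := (cutSet_closed hn (hv 0) (hv 0)).1
      rwa [mhalf, show ![v 0] = v from by ext i; fin_cases i; rfl] at h
    | len =>
      have h := (cutSet_closed hn (hv 0) (hv 0)).2.1
      rwa [mlen, show ![v 0] = v from by ext i; fin_cases i; rfl] at h
    | add =>
      have h := (cutSet_closed hn (hv 0) (hv 1)).2.2.1
      rwa [madd, show ![v 0, v 1] = v from by ext i; fin_cases i <;> rfl] at h
    | mul =>
      have h := (cutSet_closed hn (hv 0) (hv 1)).2.2.2.1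
      rwa [mmul, show ![v 0, v 1] = v from by ext i; fin_cases i <;> rfl] at h
    | smash =>
      have h := (cutSet_closed hn (hv 0) (hv 1)).2.2.2.2
      rwa [msmash, show ![v 0, v 1] = v from by ext i; fin_cases i <;> rfl] at h

/-- The singleton of a pair is (coded by) a condition. -/
theorem exists_single (a b : M) (ha : mlt a (madd n mone)) (hb : mlt b n) :
    ∃ σ : Cond n, ∀ z, mmem z σ.1 ↔ z = mpair a b := by
  obtain ⟨w, hw⟩ := exists_len_eq (mpair a b)
  obtain ⟨u, hu⟩ := exists_len_eq (mpair (mpair a b) mzero)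
  have h1 : ∀ z, mmem z (msmash w mone) ↔ z = mpair a b := fun z => by
    rw [mmem_singleton, hw]
  have h2 : ∀ z, mmem z (msmash u mone) ↔ z = mpair (mpair a b) mzero := fun z => by
    rw [mmem_singleton, hu]
  refine ⟨⟨msmash w mone, ?_, ?_, ?_, 0, msmash u mone, ?_, ?_, ?_⟩, h1⟩
  · intro z hz
    exact ⟨a, b, (h1 z).1 hz, ha, hb⟩
  · intro x y y' h h'
    rw [h1] at h h'
    rw [(mpair_inj h).2, (mpair_inj h').2]
  · intro x x' y h h'
    rw [h1] at h h'
    rw [(mpair_inj h).1, (mpair_inj h').1]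
  · intro x hx
    rw [h1] at hx
    exact ⟨mzero, zero_lt_mone, by rw [h2, hx]⟩
  · intro x y y' h h'
    rw [h2] at h h'
    rw [(mpair_inj h).2, (mpair_inj h').2]
  · intro x x' y h h'
    rw [h2] at h h'
    rw [(mpair_inj h).1, (mpair_inj h').1]

/-- The condition `{(a, b)}`. -/
noncomputable def single (a b : M) (ha : mlt a (madd n mone)) (hb : mlt b n) : Cond n :=
  (exists_single a b ha hb).choose

theorem mmem_single (a b : M) (ha : mlt a (madd n mone)) (hb : mlt b n) (z : M) :
    mmem z (single a b ha hb).1 ↔ z = mpair a b :=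
  (exists_single a b ha hb).choose_spec z

end Cut

/-! ## Formulas with `R` and forcing -/

/-- The binary relation symbol `R`. -/
inductive OracleRel : ℕ → Type
  | R : OracleRel 2

abbrev oracle : Language := ⟨fun _ => Empty, OracleRel⟩

/-- The language `L(R)`. -/
abbrev arithR : Language := arith.sum oracle

section Formulas

variable {A : Type u}

/-- The symbols `R`, `<` and `|·|` in the language `L(R)` with constants for parameters. -/
def symR : arithR[[A]].Relations 2 := Sum.inl (Sum.inr OracleRel.R)
def symLt : arithR[[A]].Relations 2 := Sum.inl (Sum.inl ArithRel.lt)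
def symLen : arithR[[A]].Functions 1 := Sum.inl (Sum.inl ArithFunc.len)

/-- The atomic sentence `R(a, b)` with parameters `a`, `b`. -/
def atomR (a b : A) : arithR[[A]].Sentence :=
  Relations.formula₂ symR (arithR.con a).term (arithR.con b).term

/-- The formula `x < |t|`, where `x` is the last variable and does not occur in `t`. -/
def ltLen {α : Type} {k : ℕ} (t : arithR[[A]].Term (α ⊕ Fin k)) :
    arithR[[A]].BoundedFormula α (k + 1) :=
  Relations.boundedFormula₂ symLt (&(Fin.last k))
    (Functions.apply₁ symLen (t.relabel (Sum.map id Fin.castSucc)))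

/-- Sharply bounded formulas: built from atomic formulas by connectives and by the quantifiers
`∀ x < |t|` and `∃ x < |t|`. (The connectives `¬`, `∧`, `∨` are abbreviations in terms of `⊥`
and `→`.) -/
inductive SharplyBounded {α : Type} : ∀ {k : ℕ}, arithR[[A]].BoundedFormula α k → Prop
  | falsum {k : ℕ} : SharplyBounded (⊥ : arithR[[A]].BoundedFormula α k)
  | equal {k : ℕ} (t u : arithR[[A]].Term (α ⊕ Fin k)) : SharplyBounded (t =' u)
  | rel {k l : ℕ} (r : arithR[[A]].Relations l) (ts : Fin l → arithR[[A]].Term (α ⊕ Fin k)) :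
      SharplyBounded (r.boundedFormula ts)
  | imp {k : ℕ} {φ ψ : arithR[[A]].BoundedFormula α k} :
      SharplyBounded φ → SharplyBounded ψ → SharplyBounded (φ ⟹ ψ)
  | all {k : ℕ} (t : arithR[[A]].Term (α ⊕ Fin k)) {ψ : arithR[[A]].BoundedFormula α (k + 1)} :
      SharplyBounded ψ → SharplyBounded (∀' (ltLen t ⟹ ψ))
  | ex {k : ℕ} (t : arithR[[A]].Term (α ⊕ Fin k)) {ψ : arithR[[A]].BoundedFormula α (k + 1)} :
      SharplyBounded ψ → SharplyBounded (∃' (ltLen t ⊓ ψ))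

/-- The sentence `φ(a₁, …, aₖ)` obtained from `φ(x₁, …, xₖ)` by substituting parameters. -/
def instantiate {k : ℕ} (φ : arithR[[A]].BoundedFormula Empty k) (a : Fin k → A) :
    arithR[[A]].Sentence :=
  φ.toFormula.subst (Sum.elim Empty.elim fun i => (arithR.con (a i)).term)

end Formulas

section Forcing

variable {M : Type u} [arith.Structure M] [M ⊨ arith.completeTheory ℕ] {n : M}

/-- The `L(R)`-structure `(𝕀, R_G)`. -/
@[reducible] def genericStructure (hn : Nonstandard n) (G : Set (Cond n)) :
    arithR.Structure (cut hn) :=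
  letI : oracle.Structure (cut hn) :=
    { funMap := fun f => nomatch f
      RelMap := fun {_} r => match r with
        | .R => fun v => genericRel G (v 0 : M) (v 1 : M) }
  inferInstance

/-- `(𝕀, R_G) ⊨ φ`, where the parameters of `φ` denote themselves. -/
def Holds (hn : Nonstandard n) (G : Set (Cond n)) (φ : arithR[[cut hn]].Sentence) : Prop :=
  letI := genericStructure hn G
  (cut hn) ⊨ φ

/-- `σ ⊩ φ`. -/
def Forces (hn : Nonstandard n) (σ : Cond n) (φ : arithR[[cut hn]].Sentence) : Prop :=
  ∀ G : Set (Cond n), IsGeneric G → σ ∈ G → Holds hn G φ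

end Forcing

end BoundedArith

open BoundedArith

namespace BoundedArith

/-! ## Coded sets in the standard model -/

section StandardModel

/-! The proof rests on two facts about generic filters. First, as `M` is countable, only countably
many sets are `ℙ`-definable, so every condition lies in some generic filter (`exists_generic`).
Second, the truth lemma (`governed_realize`, used through `exists_forces_of_holds`): a sentence true
in `(𝕀, R_G)` is forced by some condition in `G`.

The truth lemma goes by induction on formulas. Each formula receives a predicate of a condition and
a tuple that is definable in `(M, ℙ)`, is inherited by extensions, and is met in `G` exactly when
the formula is true in `(𝕀, R_G)`. An arithmetical atom ignores the condition; `R(t, u)` asks for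
the pair to be in it; `φ → ψ` asks that every extension good for `φ` extend further to one good for
`ψ`; `∀ x φ` asks that, for each `a` in `𝕀`, the conditions good for `φ(a)` be dense below. At each
step the conditions that settle the matter form a dense definable set, which `G` must meet.

Definability at the quantifier step requires the cut itself to be definable in `(M, ℙ)`, although
its definition speaks of standard exponents. It is: `m ∈ 𝕀` iff some condition contains all pairs
`(x, x)` with `x < |m|` (`mem_cutSet_iff_exists_cond`), by the pigeonhole principle and the bound on
the size of conditions.

The clauses follow. Those for `∧` and `∀` are immediate. For `¬`, a condition forcing both `φ` and
`¬φ` would contradict the existence of generic filters, and a failure of `¬φ` in some `G` is forced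
below `σ`. Disjunction and `∃` are one density argument (`forces_iff_of_holds_iff_exists`). For
`R(a, b)`, a condition omitting `(a, b)` can be extended so that some `a' ≠ a` is sent to `b`: its
domain is too small to exhaust `[n + 1] \ {a}`, since `|n|^c + 1 < n`.

The arithmetic of coded sets is proved in `ℕ`, where `mmem` is the bit test, and transferred to `M`.
-/

theorem nat_isTwoPow (e p : ℕ) : IsTwoPow e p ↔ p = 2 ^ e := by
  constructor
  · rintro ⟨w, rfl, rfl⟩
    simp [nat_len, nat_smash, nat_one]
  · rintro rfl
    obtain ⟨w, hw⟩ : ∃ w : ℕ, Nat.size w = e := by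
      rcases Nat.eq_zero_or_pos e with h | h
      · exact ⟨0, by simp [h]⟩
      · exact ⟨2 ^ (e - 1), by rw [Nat.size_pow]; omega⟩
    exact ⟨w, hw, by simp [nat_smash, nat_one, hw]⟩

theorem nat_mmem (x s : ℕ) : mmem x s ↔ s.testBit x = true := by
  simp only [mmem, nat_isTwoPow, nat_add, nat_mul, nat_lt]
  rw [Nat.testBit_eq_decide_div_mod_eq, decide_eq_true_iff]
  have hpos := Nat.two_pow_pos x
  constructor
  · rintro ⟨p, q, r, rfl, rfl, hr⟩
    -- The bits of `s` above position `x` form `q`, those below form `r`; dividing by `2 ^ x` leaves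
    -- an odd number.
    have : (q * (2 ^ x + 2 ^ x) + 2 ^ x + r) / 2 ^ x = 2 * q + 1 := by
      rw [Nat.div_eq_iff hpos]
      have e : (2 * q + 1) * 2 ^ x = q * (2 ^ x + 2 ^ x) + 2 ^ x := by ring
      omega
    omega
  · intro h
    refine ⟨2 ^ x, s / 2 ^ x / 2, s % 2 ^ x, rfl, ?_, Nat.mod_lt _ hpos⟩
    have h1 := Nat.div_add_mod s (2 ^ x)
    have h2 := Nat.div_add_mod (s / 2 ^ x) 2
    rw [h] at h2
    generalize s / 2 ^ x = a at *
    have e : a / 2 * (2 ^ x + 2 ^ x) + 2 ^ x = 2 ^ x * (2 * (a / 2) + 1) := by ring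
    rw [e, h2, h1]

/-- The finite set coded by a natural number. -/
def codedFinset (s : ℕ) : Finset ℕ := (Finset.range s.size).filter fun x => s.testBit x = true

theorem mem_codedFinset {x s : ℕ} : x ∈ codedFinset s ↔ mmem x s := by
  rw [codedFinset, Finset.mem_filter, nat_mmem, Finset.mem_range, and_iff_right_iff_imp]
  intro h
  by_contra hx
  have := Nat.testBit_lt_two_pow (i := x) (Nat.size_le.1 (not_lt.1 hx))
  simp [h] at this

theorem exists_code (S : Finset ℕ) : ∃ s : ℕ, ∀ x, mmem x s ↔ x ∈ S := by
  induction S using Finset.induction with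
  | empty => exact ⟨0, by simp [nat_mmem]⟩
  | insert a S _ ih =>
    obtain ⟨s, hs⟩ := ih
    refine ⟨2 ^ a ||| s, fun x => ?_⟩
    rw [Finset.mem_insert, ← hs x, nat_mmem, nat_mmem, Nat.testBit_lor, Nat.testBit_two_pow,
      Bool.or_eq_true, decide_eq_true_iff, @eq_comm _ a x]

theorem nat_cardLE (s k : ℕ) : CardLE s k ↔ (codedFinset s).card ≤ k := by
  constructor
  · rintro ⟨f, h1, -, h3⟩
    choose! g hg using h1
    rw [← Finset.card_range k]
    refine Finset.card_le_card_of_injOn g (fun x hx => ?_) (fun x hx y hy hxy => ?_)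
    · exact Finset.mem_coe.2 (Finset.mem_range.2 (hg x (mem_codedFinset.1 hx)).1)
    · have hx' := (hg x (mem_codedFinset.1 hx)).2
      have hy' := (hg y (mem_codedFinset.1 hy)).2
      rw [← hxy] at hy'
      exact h3 _ _ _ hx' hy'
  · intro h
    obtain ⟨g, hg, hinj⟩ : ∃ g : ℕ → ℕ, (∀ x ∈ codedFinset s, g x < k) ∧
        Set.InjOn g (codedFinset s) := by
      refine ⟨fun x => if hx : x ∈ codedFinset s then (codedFinset s).equivFin ⟨x, hx⟩ else 0,
        fun x hx => ?_, fun x hx y hy hxy => ?_⟩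
      · simp only [dif_pos hx]
        exact (Fin.is_lt _).trans_le h
      · rw [Finset.mem_coe] at hx hy
        simp only [dif_pos hx, dif_pos hy] at hxy
        exact congrArg Subtype.val ((codedFinset s).equivFin.injective (Fin.ext hxy))
    obtain ⟨f, hf⟩ := exists_code ((codedFinset s).image fun x => mpair x (g x))
    have key : ∀ x y, mmem (mpair x y) f ↔ mmem x s ∧ y = g x := by
      intro x y
      rw [hf, Finset.mem_image]
      constructor
      · rintro ⟨a, ha, hab⟩
        obtain ⟨rfl, rfl⟩ := mpair_inj hab
        exact ⟨mem_codedFinset.1 ha, rfl⟩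
      · rintro ⟨hx, rfl⟩
        exact ⟨x, mem_codedFinset.2 hx, rfl⟩
    refine ⟨f, fun x hx => ⟨g x, ?_, (key _ _).2 ⟨hx, rfl⟩⟩, ?_, ?_⟩
    · exact hg _ (mem_codedFinset.2 hx)
    · intro x y y' hy hy'
      rw [key] at hy hy'
      rw [hy.2, hy'.2]
    · intro x x' y hx hx'
      rw [key] at hx hx'
      exact hinj (mem_codedFinset.2 hx.1) (mem_codedFinset.2 hx'.1) (hx.2.symm.trans hx'.2)

theorem nat_cardLE_insert {s z s' k : ℕ} (h : ∀ y, mmem y s' ↔ mmem y s ∨ y = z)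
    (hs : CardLE s k) : CardLE s' (k + 1) := by
  rw [nat_cardLE] at hs ⊢
  have : codedFinset s' ⊆ insert z (codedFinset s) := by
    intro y hy
    rw [mem_codedFinset, h] at hy
    rw [Finset.mem_insert, mem_codedFinset]
    tauto
  exact (Finset.card_le_card this).trans
    ((Finset.card_insert_le _ _).trans (Nat.add_le_add_right hs 1))

/-- The pigeonhole principle. -/
theorem nat_pigeonhole {s k N a : ℕ} (hs : CardLE s k)
    (h : ∀ x, x < N → x ≠ a → ∃ y, mmem (mpair x y) s) : N ≤ k + 1 := by
  rw [nat_cardLE] at hs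
  choose! g hg using h
  have h1 : ((Finset.range N).erase a).card ≤ (codedFinset s).card := by
    refine Finset.card_le_card_of_injOn (fun x => mpair x (g x)) (fun x hx => ?_)
      (fun x _ y _ hxy => (mpair_inj hxy).1)
    rw [Finset.mem_coe, Finset.mem_erase, Finset.mem_range] at hx
    exact mem_codedFinset.2 (hg x hx.2 hx.1)
  have h2 := Finset.pred_card_le_card_erase (s := Finset.range N) (a := a)
  rw [Finset.card_range] at h2
  omega

theorem nat_exists_diagonal (N : ℕ) :
    ∃ s : ℕ, (∀ z, mmem z s ↔ ∃ x, x < N ∧ z = mpair x x) ∧ CardLE s N := by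
  obtain ⟨s, hs⟩ := exists_code ((Finset.range N).image fun x => mpair x x)
  refine ⟨s, fun z => ?_, ?_⟩
  · rw [hs, Finset.mem_image]
    simp only [Finset.mem_range, eq_comm]
  · rw [nat_cardLE]
    have : codedFinset s = (Finset.range N).image fun x => mpair x x := by
      ext z; rw [mem_codedFinset, hs]
    rw [this]
    exact Finset.card_image_le.trans (Finset.card_range N).le

/-- Exponentials outgrow polynomials. Transferred, this puts every `|n|^c` with standard `c` well
below a non-standard `n`. -/
theorem exists_size_pow_lt (c : ℕ) : ∃ N : ℕ, ∀ x, N < x → x.size ^ c + 2 < x := by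
  have h : (fun L : ℕ => (L : ℝ) ^ (c + 1)) =o[Filter.atTop] fun L : ℕ => (2 : ℝ) ^ L :=
    isLittleO_pow_const_const_pow_of_one_lt _ one_lt_two
  have h1 := h.def (c := 1) one_pos
  rw [Filter.eventually_atTop] at h1
  obtain ⟨L0, hL0⟩ := h1
  -- The `7` makes `|x| ≥ 8`. Then `|x|^(c+1) ≤ 2^|x| ≤ 2x` gives `4|x|^c ≤ x`, and `|x|^c ≥ 1`
  -- absorbs the summand `2`.
  refine ⟨2 ^ (L0 + 7), fun x hx => ?_⟩
  have hL : L0 + 7 < x.size := Nat.lt_size.2 hx.le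
  obtain ⟨L, hL'⟩ : ∃ L, x.size = L + 1 := ⟨x.size - 1, by omega⟩
  have hx2 : 2 ^ L ≤ x := Nat.lt_size.1 (by omega)
  have h2 := hL0 x.size (by omega)
  simp only [Real.norm_eq_abs, one_mul] at h2
  rw [abs_of_nonneg (by positivity), abs_of_nonneg (by positivity)] at h2
  have h3 : x.size ^ (c + 1) ≤ 2 ^ x.size := by exact_mod_cast h2
  rw [hL', pow_succ, pow_succ] at h3
  have h4 : 1 ≤ (L + 1) ^ c := Nat.one_le_pow _ _ (by omega)
  rw [hL']
  nlinarith

end StandardModel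

/-! ## Transfer to models of true arithmetic -/

section Formulas

variable {k : ℕ}

/-- Weakening of a term by one variable. -/
def tlift {L : Language} (t : L.Term (Empty ⊕ Fin k)) : L.Term (Empty ⊕ Fin (k + 1)) :=
  t.relabel (Sum.map id Fin.castSucc)

/-- The last variable. -/
def tlast {L : Language} : L.Term (Empty ⊕ Fin (k + 1)) := Term.var (Sum.inr (Fin.last k))

theorem realize_tlift {L : Language} {M : Type*} [L.Structure M] (t : L.Term (Empty ⊕ Fin k))
    (v : Empty → M) (xs : Fin k → M) (x : M) :
    (tlift t).realize (Sum.elim v (Fin.snoc xs x)) = t.realize (Sum.elim v xs) := by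
  rw [tlift, Term.realize_relabel]
  congr 1
  funext i
  rcases i with i | i
  · exact i.elim
  · simp

theorem realize_tlast {L : Language} {M : Type*} [L.Structure M]
    (v : Empty → M) (xs : Fin k → M) (x : M) :
    (tlast : L.Term (Empty ⊕ Fin (k + 1))).realize (Sum.elim v (Fin.snoc xs x)) = x := by
  simp [tlast]

/-- The term for `mpair`. -/
def tpair (t u : arith.Term (Empty ⊕ Fin k)) : arith.Term (Empty ⊕ Fin k) :=
  tadd (tmul (tadd t u) (tadd t u)) t

/-- The formula for `IsTwoPow`. -/
def ftwoPow (t u : arith.Term (Empty ⊕ Fin k)) : arith.BoundedFormula Empty k :=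
  ∃' ((tlen tlast =' tlift t) ⊓ (tlift u =' tsmash tlast tone))

/-- The formula for `mmem`. -/
def fmem (t u : arith.Term (Empty ⊕ Fin k)) : arith.BoundedFormula Empty k :=
  ∃' ∃' ∃' (ftwoPow (tlift (tlift (tlift t))) (tlift (tlift tlast)) ⊓
    ((tlift (tlift (tlift u)) ='
      tadd (tadd (tmul (tlift tlast) (tadd (tlift (tlift tlast)) (tlift (tlift tlast))))
        (tlift (tlift tlast))) tlast) ⊓
    tlt tlast (tlift (tlift tlast))))

/-- The formula for `CardLE`. -/
def fcardLE (t u : arith.Term (Empty ⊕ Fin k)) : arith.BoundedFormula Empty k :=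
  ∃' ((∀' (fmem tlast (tlift (tlift t)) ⟹
      ∃' (tlt tlast (tlift (tlift (tlift u))) ⊓
        fmem (tpair (tlift tlast) tlast) (tlift (tlift tlast))))) ⊓
    ((∀' ∀' ∀' (fmem (tpair (tlift (tlift tlast)) (tlift tlast)) (tlift (tlift (tlift tlast))) ⟹
      (fmem (tpair (tlift (tlift tlast)) tlast) (tlift (tlift (tlift tlast))) ⟹
        (tlift tlast =' tlast)))) ⊓
    (∀' ∀' ∀' (fmem (tpair (tlift (tlift tlast)) tlast) (tlift (tlift (tlift tlast))) ⟹
      (fmem (tpair (tlift tlast) tlast) (tlift (tlift (tlift tlast))) ⟹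
        (tlift (tlift tlast) =' tlift tlast))))))

variable {M : Type u} [arith.Structure M] (v : Empty → M) (xs : Fin k → M)
  (t w : arith.Term (Empty ⊕ Fin k))

theorem realize_tpair : (tpair t w).realize (Sum.elim v xs) =
    mpair (t.realize (Sum.elim v xs)) (w.realize (Sum.elim v xs)) := by
  simp only [tpair, mpair, realize_tadd, realize_tmul]

theorem realize_ftwoPow : (ftwoPow t w).Realize v xs ↔
    IsTwoPow (t.realize (Sum.elim v xs)) (w.realize (Sum.elim v xs)) := by
  simp only [ftwoPow, IsTwoPow, BoundedFormula.realize_ex, BoundedFormula.realize_inf,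
    BoundedFormula.realize_bdEqual, realize_tlen, realize_tlast, realize_tlift, realize_tsmash,
    realize_tone]

theorem realize_fmem : (fmem t w).Realize v xs ↔
    mmem (t.realize (Sum.elim v xs)) (w.realize (Sum.elim v xs)) := by
  simp only [fmem, mmem, BoundedFormula.realize_ex, BoundedFormula.realize_inf,
    BoundedFormula.realize_bdEqual, realize_tlast, realize_tlift, realize_tadd, realize_tmul,
    realize_ftwoPow, realize_tlt]

theorem realize_fcardLE : (fcardLE t w).Realize v xs ↔
    CardLE (t.realize (Sum.elim v xs)) (w.realize (Sum.elim v xs)) := by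
  simp only [fcardLE, CardLE, BoundedFormula.realize_ex, BoundedFormula.realize_inf,
    BoundedFormula.realize_all, BoundedFormula.realize_imp,
    BoundedFormula.realize_bdEqual, realize_tlast, realize_tlift, realize_tpair,
    realize_fmem, realize_tlt]

/-- The numeral for `j`. -/
def tnumeral : ℕ → arith.Term (Empty ⊕ Fin k)
  | 0 => tzero
  | j + 1 => tadd (tnumeral j) tone

/-- The term for `mpow`. -/
def tpow (t : arith.Term (Empty ⊕ Fin k)) : ℕ → arith.Term (Empty ⊕ Fin k)
  | 0 => tone
  | c + 1 => tmul t (tpow t c)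

theorem realize_tnumeral (j : ℕ) :
    (tnumeral j : arith.Term (Empty ⊕ Fin k)).realize (Sum.elim v xs) = numeral j := by
  induction j with
  | zero => exact realize_tzero _
  | succ j ih => rw [tnumeral, realize_tadd, ih, realize_tone]; rfl

theorem realize_tpow (c : ℕ) :
    (tpow t c).realize (Sum.elim v xs) = mpow (t.realize (Sum.elim v xs)) c := by
  induction c with
  | zero => exact realize_tone _
  | succ c ih => rw [tpow, realize_tmul, ih]; rfl

theorem nat_numeral (j : ℕ) : (numeral j : ℕ) = j := by
  induction j with
  | zero => rfl
  | succ j ih => rw [numeral, ih]; rfl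

theorem nat_mpow (x c : ℕ) : mpow x c = x ^ c := by
  induction c with
  | zero => rfl
  | succ c ih => rw [mpow, ih, pow_succ, mul_comm]; rfl

end Formulas

section Transfer

variable {M : Type u} [arith.Structure M] [M ⊨ arith.completeTheory ℕ]

attribute [local simp] realize_tzero realize_tone realize_tlen realize_tadd
  realize_tmul realize_tsmash realize_tlt nat_zero nat_one nat_len nat_add nat_mul
  nat_smash nat_lt Fin.snoc realize_tpair realize_fmem realize_fcardLE realize_tnumeral
  realize_tpow nat_numeral nat_mpow

/-! ### Coded sets inside the model. -/

theorem exists_insert (s z : M) : ∃ s' : M, (∀ y, mmem y s' ↔ mmem y s ∨ y = z) ∧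
    ∀ k, CardLE s k → CardLE s' (madd k mone) := by
  have := transfer (M := M) (k := 2)
    (∃' ((∀' ((fmem (&3) (&2)).iff (fmem (&3) (&0) ⊔ ((&3) =' (&1))))) ⊓
      ∀' (fcardLE (&0) (&3) ⟹ fcardLE (&2) (tadd (&3) tone))))
    (by
      intro v xs
      simp
      obtain ⟨s', h⟩ := exists_code (insert (xs 1) (codedFinset (xs 0)))
      have h' : ∀ y, mmem y s' ↔ mmem y (xs 0) ∨ y = xs 1 := fun y => by
        rw [h, Finset.mem_insert, mem_codedFinset, or_comm]
      exact ⟨s', h', fun _ => nat_cardLE_insert h'⟩) Empty.elim ![s, z]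
  simpa using this

/-- One number `a` is exempted so that the contrapositive yields a point outside the domain and
different from `a`. -/
theorem pigeonhole {s k N a : M} (hs : CardLE s k)
    (h : ∀ x, mlt x N → x ≠ a → ∃ y, mmem (mpair x y) s) : ¬ mlt (madd k mone) N := by
  have := transfer (M := M) (k := 4)
    (fcardLE (&0) (&1) ⟹ ((∀' (tlt (&4) (&2) ⟹ (∼((&4) =' (&3)) ⟹
      ∃' (fmem (tpair (&4) (&5)) (&0))))) ⟹ ∼(tlt (tadd (&1) tone) (&2))))
    (by
      intro v xs
      simp
      exact fun h1 h2 => nat_pigeonhole h1 h2) Empty.elim ![s, k, N, a]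
  simp at this
  exact this hs h

/-- For `N = |m|` with `m` in the cut, this identity map is the condition that witnesses membership
of `m`. -/
theorem exists_diagonal (N : M) :
    ∃ s : M, (∀ z, mmem z s ↔ ∃ x, mlt x N ∧ z = mpair x x) ∧ CardLE s N := by
  have := transfer (M := M) (k := 1)
    (∃' ((∀' ((fmem (&2) (&1)).iff (∃' (tlt (&3) (&0) ⊓ ((&2) =' tpair (&3) (&3)))))) ⊓
      fcardLE (&1) (&0)))
    (by
      intro v xs
      simp
      exact nat_exists_diagonal _) Empty.elim ![N]
  simpa using this

/-- Here and below `k ≤ l` appears as `¬ mlt l k`, because `L` has only the strict order. -/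
theorem cardLE_mono {s k l : M} (hs : CardLE s k) (h : ¬ mlt l k) : CardLE s l := by
  have := transfer (M := M) (k := 3)
    (fcardLE (&0) (&1) ⟹ (∼(tlt (&2) (&1)) ⟹ fcardLE (&0) (&2)))
    (by
      intro v xs
      simp
      intro h1 h2
      rw [nat_cardLE] at h1 ⊢
      omega) Empty.elim ![s, k, l]
  simp at this
  exact this hs h

/-! ### Order, powers of `|n|` and the cut. -/

theorem Nonstandard.numeral_lt {n : M} (hn : Nonstandard n) (j : ℕ) : mlt (numeral j) n := by
  induction j with
  | zero =>
    have := transfer (M := M) (k := 1) (((&0) =' tzero) ⊔ tlt tzero (&0))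
      (by intro v xs; simp; omega) Empty.elim ![n]
    simp at this
    exact this.resolve_left (hn 0)
  | succ j ih =>
    have := transfer (M := M) (k := 2)
      (tlt (&0) (&1) ⟹ (((&1) =' tadd (&0) tone) ⊔ tlt (tadd (&0) tone) (&1)))
      (by intro v xs; simp; omega) Empty.elim ![numeral j, n]
    simp at this
    exact (this ih).resolve_left (hn (j + 1))

/-- For fixed `c` the threshold of `exists_size_pow_lt` is a standard number, so the bound is a
single sentence with a numeral, and `n` exceeds all numerals. -/
theorem Nonstandard.pow_len_lt {n : M} (hn : Nonstandard n) (c : ℕ) :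
    mlt (madd (madd (mpow (mlen n) c) mone) mone) n := by
  obtain ⟨N, hN⟩ := exists_size_pow_lt c
  have := transfer (M := M) (k := 1)
    (tlt (tnumeral N) (&0) ⟹ tlt (tadd (tadd (tpow (tlen (&0)) c) tone) tone) (&0))
    (by
      intro v xs
      simp
      exact hN _) Empty.elim ![n]
  simp at this
  exact this (hn.numeral_lt N)

theorem lt_add_one_self (x : M) : mlt x (madd x mone) := by
  have := transfer (M := M) (k := 1) (tlt (&0) (tadd (&0) tone))
    (by intro v xs; simp) Empty.elim ![x]
  simpa using this

theorem mlt_of_mlt_of_not_mlt {x y z : M} (h : mlt x y) (h' : ¬ mlt z y) : mlt x z := by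
  have := transfer (M := M) (k := 3) (tlt (&0) (&1) ⟹ (∼(tlt (&2) (&1)) ⟹ tlt (&0) (&2)))
    (by intro v xs; simp; omega) Empty.elim ![x, y, z]
  simp at this
  exact this h h'

theorem mlt_of_not_mlt_of_mlt {x y z : M} (h : ¬ mlt y x) (h' : mlt y z) : mlt x z := by
  have := transfer (M := M) (k := 3) (∼(tlt (&1) (&0)) ⟹ (tlt (&1) (&2) ⟹ tlt (&0) (&2)))
    (by intro v xs; simp; omega) Empty.elim ![x, y, z]
  simp at this
  exact this h h'

theorem mlt_trans {x y z : M} (h : mlt x y) (h' : mlt y z) : mlt x z := by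
  have := transfer (M := M) (k := 3) (tlt (&0) (&1) ⟹ (tlt (&1) (&2) ⟹ tlt (&0) (&2)))
    (by intro v xs; simp; omega) Empty.elim ![x, y, z]
  simp at this
  exact this h h'

theorem mul_len_ge {m k : M} (hm : mlt mone m) (hk : mlt mzero k) :
    ¬ mlt (mmul (mlen m) k) (madd k mone) := by
  have := transfer (M := M) (k := 2)
    (tlt tone (&0) ⟹ (tlt tzero (&1) ⟹ ∼(tlt (tmul (tlen (&0)) (&1)) (tadd (&1) tone))))
    (by
      intro v xs
      simp
      intro h1 h2
      have h3 : 2 ≤ (xs 0).size := Nat.lt_size.2 (by rw [pow_one]; exact h1)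
      nlinarith) Empty.elim ![m, k]
  simp at this
  exact this hm hk

theorem lt_twoPow_iff (m w : M) : mlt m (msmash w mone) ↔ ¬ mlt (mlen w) (mlen m) := by
  have := transfer (M := M) (k := 2)
    ((tlt (&0) (tsmash (&1) tone)).iff ∼(tlt (tlen (&1)) (tlen (&0))))
    (by
      intro v xs
      simp [Nat.size_le]) Empty.elim ![m, w]
  simpa using this

/-- Raising the exponent by one pays for one additional element. -/
theorem mpow_len_succ_ge {n : M} (hn : Nonstandard n) (c : ℕ) :
    ¬ mlt (mpow (mlen n) (c + 1)) (madd (mpow (mlen n) c) mone) :=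
  mul_len_ge hn.one_lt (mpow_pos hn c)

theorem mem_cutSet_iff {n m : M} :
    m ∈ cutSet n ↔ ∃ c : ℕ, ¬ mlt (mpow (mlen n) c) (mlen m) := by
  constructor
  · rintro ⟨c, p, ⟨w, hw, rfl⟩, h⟩
    exact ⟨c, by rwa [lt_twoPow_iff, hw] at h⟩
  · rintro ⟨c, h⟩
    obtain ⟨w, hw⟩ := exists_len_eq (mpow (mlen n) c)
    exact ⟨c, _, ⟨w, hw, rfl⟩, by rwa [lt_twoPow_iff, hw]⟩

/-! ## Conditions -/

variable {n : M}

/-- The cut is definable from the set of conditions. -/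
theorem mem_cutSet_iff_exists_cond (hn : Nonstandard n) (m : M) :
    m ∈ cutSet n ↔ ∃ s, IsCondition n s ∧ ∀ x, mlt x (mlen m) → mmem (mpair x x) s := by
  rw [mem_cutSet_iff]
  constructor
  -- The diagonal on `|m| ≤ |n|^c` is small enough to be a condition, and its entries are below `n`
  -- because `|n|^c < n`.
  · rintro ⟨c, hc⟩
    obtain ⟨s, hs, hcard⟩ := exists_diagonal (mlen m)
    have hlt : ∀ x, mlt x (mlen m) → mlt x n := fun x hx =>
      mlt_trans (mlt_trans (mlt_of_mlt_of_not_mlt hx hc) (lt_add_one_self _))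
        (mlt_trans (lt_add_one_self _) (hn.pow_len_lt c))
    refine ⟨s, ⟨?_, ?_, ?_, c, cardLE_mono hcard hc⟩, fun x hx => (hs _).2 ⟨x, hx, rfl⟩⟩
    · intro z hz
      obtain ⟨x, hx, rfl⟩ := (hs z).1 hz
      exact ⟨x, x, rfl, lt_succ_of_lt (hlt x hx), hlt x hx⟩
    · intro a b b' h h'
      obtain ⟨x, -, hx⟩ := (hs _).1 h
      obtain ⟨y, -, hy⟩ := (hs _).1 h'
      rw [(mpair_inj hx).2, (mpair_inj hy).2, ← (mpair_inj hx).1, ← (mpair_inj hy).1]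
    · intro a a' b h h'
      obtain ⟨x, -, hx⟩ := (hs _).1 h
      obtain ⟨y, -, hy⟩ := (hs _).1 h'
      rw [(mpair_inj hx).1, (mpair_inj hy).1, ← (mpair_inj hx).2, ← (mpair_inj hy).2]
  · rintro ⟨s, hs, h⟩
    obtain ⟨c, hc⟩ := hs.size
    -- A condition of size at most `|n|^c` containing the diagonal gives `|m| ≤ |n|^c + 1 ≤
    -- |n|^(c+1)`. The exempted point is not needed here and is set to `0`.
    refine ⟨c + 1, fun hlt => ?_⟩
    exact pigeonhole (a := mzero) hc (fun x hx _ => ⟨x, h x hx⟩)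
      (mlt_of_not_mlt_of_mlt (mpow_len_succ_ge hn c) hlt)

/-- The domain of a condition omits a number `a'` different from a given `a`. -/
theorem exists_notMem_domain (hn : Nonstandard n) (σ : Cond n) (a : M) :
    ∃ a', mlt a' (madd n mone) ∧ a' ≠ a ∧ ∀ b, ¬ σ.Has a' b := by
  by_contra! h
  obtain ⟨c, hc⟩ := σ.2.size
  -- Otherwise the `n` points of `[n + 1]` other than `a` would force `n ≤ |n|^c`.
  refine pigeonhole (N := madd n mone) (a := a) hc h ?_
  exact mlt_trans (mlt_trans (lt_add_one_self _) (hn.pow_len_lt c)) (lt_add_one_self n)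

/-- Extending a condition by one pair. -/
theorem exists_extension (hn : Nonstandard n) (σ : Cond n) {a b : M} (ha : mlt a (madd n mone))
    (hb : mlt b n) (ha' : ∀ y, ¬ σ.Has a y) (hb' : ∀ x, ¬ σ.Has x b) :
    ∃ τ : Cond n, τ ≤ σ ∧ τ.Has a b := by
  obtain ⟨s, hs, hcard⟩ := exists_insert σ.1 (mpair a b)
  have key : ∀ x y, mmem (mpair x y) s ↔ σ.Has x y ∨ (x = a ∧ y = b) := fun x y => by
    rw [hs, Cond.Has]
    refine or_congr_right ⟨fun h => mpair_inj h, ?_⟩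
    rintro ⟨rfl, rfl⟩
    rfl
  refine ⟨⟨s, ?_, ?_, ?_, ?_⟩, fun x y h => (key x y).2 (.inl h), (key a b).2 (.inr ⟨rfl, rfl⟩)⟩
  · intro z hz
    rcases (hs z).1 hz with h | rfl
    · exact σ.2.sub z h
    · exact ⟨a, b, rfl, ha, hb⟩
  · intro x y y' h h'
    rcases (key _ _).1 h with h | ⟨rfl, rfl⟩ <;> rcases (key _ _).1 h' with h' | ⟨h1, rfl⟩
    · exact σ.2.functional _ _ _ h h'
    · exact absurd (h1 ▸ h) (ha' _)
    · exact absurd h' (ha' _)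
    · rfl
  · intro x x' y h h'
    rcases (key _ _).1 h with h | ⟨rfl, rfl⟩ <;> rcases (key _ _).1 h' with h' | ⟨rfl, h1⟩
    · exact σ.2.injective _ _ _ h h'
    · exact absurd (h1 ▸ h) (hb' _)
    · exact absurd h' (hb' _)
    · rfl
  · obtain ⟨c, hc⟩ := σ.2.size
    exact ⟨c + 1, cardLE_mono (hcard _ hc) (mpow_len_succ_ge hn c)⟩

end Transfer

/-! ## Definability in the expansion by the set of conditions -/

section Definability

variable {M : Type u} [arith.Structure M]

/-- The language of `(M, ℙ)` with parameters from `M`. -/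
abbrev condLangParam (M : Type u) : Language := (arith.sum condLang)[[(Set.univ : Set M)]]

/-- Definability of a predicate in `(M, ℙ)`, with parameters. -/
def DefPred (n : M) {k : ℕ} (P : (Fin k → M) → Prop) : Prop :=
  letI := expansion n
  ∃ φ : (condLangParam M).BoundedFormula Empty k, ∀ v, φ.Realize default v ↔ P v

/-- Functions given by terms in `(M, ℙ)`, with parameters. -/
def TermFun (n : M) {k : ℕ} (f : (Fin k → M) → M) : Prop :=
  letI := expansion n
  ∃ t : (condLangParam M).Term (Empty ⊕ Fin k), ∀ v, t.realize (Sum.elim default v) = f v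

variable {n : M} {k : ℕ} {P Q : (Fin k → M) → Prop} {f g : (Fin k → M) → M}

theorem DefPred.congr (hP : DefPred n P) (h : ∀ v, P v ↔ Q v) : DefPred n Q :=
  let ⟨φ, hφ⟩ := hP
  ⟨φ, fun v => (hφ v).trans (h v)⟩

theorem DefPred.imp (hP : DefPred n P) (hQ : DefPred n Q) : DefPred n fun v => P v → Q v := by
  obtain ⟨φ, hφ⟩ := hP
  obtain ⟨ψ, hψ⟩ := hQ
  let _ := expansion n
  exact ⟨φ ⟹ ψ, fun v => by rw [BoundedFormula.realize_imp, hφ, hψ]⟩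

theorem defPred_false : DefPred n fun _ : Fin k → M => False :=
  ⟨⊥, fun _ => Iff.rfl⟩

theorem DefPred.not (hP : DefPred n P) : DefPred n fun v => ¬ P v := hP.imp defPred_false

theorem DefPred.and (hP : DefPred n P) (hQ : DefPred n Q) : DefPred n fun v => P v ∧ Q v :=
  (hP.imp hQ.not).not.congr fun v => by tauto

theorem DefPred.or (hP : DefPred n P) (hQ : DefPred n Q) : DefPred n fun v => P v ∨ Q v :=
  (hP.not.imp hQ).congr fun v => by tauto

/-- A quantified predicate is given as a function of the old variables and the new one. -/
theorem DefPred.all {P : (Fin k → M) → M → Prop}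
    (hP : DefPred n fun w : Fin (k + 1) → M => P (fun i => w i.castSucc) (w (Fin.last k))) :
    DefPred n fun v => ∀ x, P v x := by
  obtain ⟨φ, hφ⟩ := hP
  let _ := expansion n
  refine ⟨φ.all, fun v => ?_⟩
  rw [BoundedFormula.realize_all]
  refine forall_congr' fun x => ?_
  rw [hφ]
  simp only [Fin.snoc_castSucc, Fin.snoc_last]

theorem DefPred.ex {P : (Fin k → M) → M → Prop}
    (hP : DefPred n fun w : Fin (k + 1) → M => P (fun i => w i.castSucc) (w (Fin.last k))) :
    DefPred n fun v => ∃ x, P v x :=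
  (DefPred.all (P := fun v x => ¬ P v x) hP.not).not.congr fun v => by
    rw [not_forall_not]

theorem termFun_var (i : Fin k) : TermFun n fun v : Fin k → M => v i :=
  ⟨Term.var (Sum.inr i), fun _ => rfl⟩

theorem termFun_const (a : M) : TermFun n fun _ : Fin k → M => a :=
  let _ := expansion n
  ⟨((arith.sum condLang).con (⟨a, trivial⟩ : (Set.univ : Set M))).term, fun v => by simp⟩

theorem TermFun.weaken (hf : TermFun n f) :
    TermFun n fun w : Fin (k + 1) → M => f (fun i => w i.castSucc) := by
  let _ := expansion n
  obtain ⟨t, ht⟩ := hf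
  refine ⟨tlift t, fun w => ?_⟩
  rw [← Fin.snoc_init_self w, realize_tlift, ht]
  simp only [Fin.snoc_castSucc]

theorem termFun_funMap {l : ℕ} (F : arith.Functions l) {f : Fin l → (Fin k → M) → M}
    (hf : ∀ i, TermFun n (f i)) : TermFun n fun v => funMap F fun i => f i v := by
  let _ := expansion n
  choose t ht using hf
  refine ⟨Term.func (L := condLangParam M) (Sum.inl (Sum.inl F)) t, fun v => ?_⟩
  simp only [← ht]
  rfl

theorem TermFun.len (hf : TermFun n f) : TermFun n fun v => mlen (f v) := by
  convert termFun_funMap ArithFunc.len (f := ![f]) (by simpa using hf) using 3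
  rw [mlen]
  congr 1
  ext i; fin_cases i; rfl

theorem termFun_binary (F : arith.Functions 2) (hf : TermFun n f) (hg : TermFun n g) :
    TermFun n fun v => funMap F ![f v, g v] := by
  convert termFun_funMap (n := n) F (f := ![f, g]) (by simp [Fin.forall_fin_two, hf, hg]) using 3
  ext i; fin_cases i <;> rfl

theorem TermFun.add (hf : TermFun n f) (hg : TermFun n g) : TermFun n fun v => madd (f v) (g v) :=
  termFun_binary _ hf hg

theorem TermFun.mul (hf : TermFun n f) (hg : TermFun n g) : TermFun n fun v => mmul (f v) (g v) :=
  termFun_binary _ hf hg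

theorem TermFun.smash (hf : TermFun n f) (hg : TermFun n g) :
    TermFun n fun v => msmash (f v) (g v) :=
  termFun_binary _ hf hg

theorem TermFun.pair (hf : TermFun n f) (hg : TermFun n g) :
    TermFun n fun v => mpair (f v) (g v) :=
  ((hf.add hg).mul (hf.add hg)).add hf

theorem defPred_eq (hf : TermFun n f) (hg : TermFun n g) : DefPred n fun v => f v = g v := by
  let _ := expansion n
  obtain ⟨t, ht⟩ := hf
  obtain ⟨u, hu⟩ := hg
  refine ⟨t =' u, fun v => ?_⟩
  rw [BoundedFormula.realize_bdEqual, ht, hu]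

theorem defPred_relMap {l : ℕ} (r : arith.Relations l) {f : Fin l → (Fin k → M) → M}
    (hf : ∀ i, TermFun n (f i)) : DefPred n fun v => RelMap r fun i => f i v := by
  let _ := expansion n
  choose t ht using hf
  refine ⟨Relations.boundedFormula (L := condLangParam M) (Sum.inl (Sum.inl r)) t, fun v => ?_⟩
  simp only [← ht]
  rfl

theorem defPred_lt (hf : TermFun n f) (hg : TermFun n g) : DefPred n fun v => mlt (f v) (g v) := by
  convert defPred_relMap (n := n) ArithRel.lt (f := ![f, g]) (by simp [Fin.forall_fin_two, hf, hg]) using 2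
  rw [mlt]
  congr! 1
  ext i; fin_cases i <;> rfl

theorem defPred_isCondition (hf : TermFun n f) : DefPred n fun v => IsCondition n (f v) := by
  let _ := expansion n
  obtain ⟨t, ht⟩ := hf
  refine ⟨Relations.boundedFormula (L := condLangParam M) (Sum.inl (Sum.inr CondRel.P)) ![t],
    fun v => ?_⟩
  exact iff_of_eq (congrArg (IsCondition n) (ht v))

theorem defPred_isTwoPow (hf : TermFun n f) (hg : TermFun n g) :
    DefPred n fun v => IsTwoPow (f v) (g v) := by
  refine DefPred.ex (P := fun v w => mlen w = f v ∧ g v = msmash w mone) ?_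
  exact (defPred_eq (termFun_var _).len hf.weaken).and
    (defPred_eq hg.weaken ((termFun_var _).smash (termFun_const _)))

theorem defPred_mem (hf : TermFun n f) (hg : TermFun n g) :
    DefPred n fun v => mmem (f v) (g v) := by
  refine DefPred.ex (P := fun v p => ∃ q r, IsTwoPow (f v) p ∧
    g v = madd (madd (mmul q (madd p p)) p) r ∧ mlt r p) ?_
  refine DefPred.ex (P := fun (v : Fin (k + 1) → M) q => ∃ r,
    IsTwoPow (f fun i => v i.castSucc) (v (Fin.last k)) ∧
    (g fun i => v i.castSucc) =
      madd (madd (mmul q (madd (v (Fin.last k)) (v (Fin.last k)))) (v (Fin.last k))) r ∧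
    mlt r (v (Fin.last k))) ?_
  have hp : TermFun n fun v : Fin (k + 1) → M => v (Fin.last k) := termFun_var _
  have hq : TermFun n fun v : Fin (k + 2) → M => v (Fin.last (k + 1)) := termFun_var _
  refine DefPred.ex (P := fun (v : Fin (k + 2) → M) r =>
    IsTwoPow (f fun i => v i.castSucc.castSucc) (v (Fin.last k).castSucc) ∧
    (g fun i => v i.castSucc.castSucc) =
      madd (madd (mmul (v (Fin.last (k + 1)))
        (madd (v (Fin.last k).castSucc) (v (Fin.last k).castSucc))) (v (Fin.last k).castSucc)) r ∧
    mlt r (v (Fin.last k).castSucc)) ?_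
  have hp2 := hp.weaken.weaken
  exact (defPred_isTwoPow hf.weaken.weaken.weaken hp2).and
    ((defPred_eq hg.weaken.weaken.weaken
      (((hq.weaken.mul (hp2.add hp2)).add hp2).add (termFun_var _))).and
    (defPred_lt (termFun_var _) hp2))

/-- Inclusion of the sets of pairs coded by `s` and `t`. -/
def PairSubset (s t : M) : Prop := ∀ a b, mmem (mpair a b) s → mmem (mpair a b) t

theorem defPred_pairSubset (hf : TermFun n f) (hg : TermFun n g) :
    DefPred n fun v => PairSubset (f v) (g v) := by
  refine DefPred.all (P := fun v a => ∀ b, mmem (mpair a b) (f v) → mmem (mpair a b) (g v)) ?_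
  refine DefPred.all (P := fun (v : Fin (k + 1) → M) b =>
    mmem (mpair (v (Fin.last k)) b) (f fun i => v i.castSucc) →
    mmem (mpair (v (Fin.last k)) b) (g fun i => v i.castSucc)) ?_
  have ha : TermFun n fun v : Fin (k + 1) → M => v (Fin.last k) := termFun_var _
  have hab := ha.weaken.pair (termFun_var (Fin.last (k + 1)))
  exact (defPred_mem hab hf.weaken.weaken).imp (defPred_mem hab hg.weaken.weaken)

/-- Quantification over conditions. -/
theorem DefPred.allCond {P : (Fin k → M) → M → Prop}
    (hP : DefPred n fun w : Fin (k + 1) → M => P (fun i => w i.castSucc) (w (Fin.last k))) :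
    DefPred n fun v => ∀ τ : Cond n, P v τ.1 :=
  (DefPred.all (P := fun v τ => IsCondition n τ → P v τ)
    ((defPred_isCondition (termFun_var _)).imp hP)).congr fun _ =>
    ⟨fun h τ => h τ.1 τ.2, fun h τ hτ => h ⟨τ, hτ⟩⟩

theorem DefPred.exCond {P : (Fin k → M) → M → Prop}
    (hP : DefPred n fun w : Fin (k + 1) → M => P (fun i => w i.castSucc) (w (Fin.last k))) :
    DefPred n fun v => ∃ τ : Cond n, P v τ.1 :=
  (DefPred.allCond (P := fun v τ => ¬ P v τ) hP.not).not.congr fun v => by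
    rw [not_forall_not]

/-- The quantifier over standard exponents in `cutSet` is not first-order in `M`; it is replaced by
a quantifier over conditions. -/
theorem defPred_mem_cutSet [M ⊨ arith.completeTheory ℕ] (hn : Nonstandard n) (hf : TermFun n f) :
    DefPred n fun v => f v ∈ cutSet n := by
  have h1 : DefPred n fun v => ∃ s : Cond n, ∀ x, mlt x (mlen (f v)) → mmem (mpair x x) s.1 := by
    refine DefPred.exCond (P := fun v s => ∀ x, mlt x (mlen (f v)) → mmem (mpair x x) s) ?_
    refine DefPred.all (P := fun (v : Fin (k + 1) → M) x =>
      mlt x (mlen (f fun i => v i.castSucc)) → mmem (mpair x x) (v (Fin.last k))) ?_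
    have hs : TermFun n fun v : Fin (k + 1) → M => v (Fin.last k) := termFun_var _
    have hx : TermFun n fun v : Fin (k + 2) → M => v (Fin.last (k + 1)) := termFun_var _
    exact (defPred_lt hx hf.weaken.weaken.len).imp (defPred_mem (hx.pair hx) hs.weaken)
  refine h1.congr fun v => ?_
  rw [mem_cutSet_iff_exists_cond hn]
  exact ⟨fun ⟨s, h⟩ => ⟨s.1, s.2, h⟩, fun ⟨s, hs, h⟩ => ⟨⟨s, hs⟩, h⟩⟩

/-- Quantification over the cut. -/
theorem DefPred.allCut [M ⊨ arith.completeTheory ℕ] (hn : Nonstandard n)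
    {P : (Fin k → M) → M → Prop}
    (hP : DefPred n fun w : Fin (k + 1) → M => P (fun i => w i.castSucc) (w (Fin.last k))) :
    DefPred n fun v => ∀ a : cut hn, P v a :=
  (DefPred.all (P := fun v a => a ∈ cutSet n → P v a)
    ((defPred_mem_cutSet hn (termFun_var _)).imp hP)).congr fun _ =>
    ⟨fun h a => h a.1 a.2, fun h a ha => h ⟨a, ha⟩⟩

theorem DefPred.condDefinable {P : M → Prop} (hP : DefPred n fun v : Fin 1 → M => P (v 0)) :
    CondDefinable {σ : Cond n | P σ.1} := by
  let _ := expansion n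
  -- The set to be defined consists of codes in `M`, so the predicate for `ℙ` is conjoined.
  obtain ⟨φ, hφ⟩ := (defPred_isCondition (termFun_var (0 : Fin 1))).and hP
  refine ⟨φ.toFormula.relabel (Sum.elim Empty.elim id), ?_⟩
  ext v
  have h1 : (φ.toFormula.relabel (Sum.elim Empty.elim id)).Realize v ↔ φ.Realize default v := by
    rw [Formula.realize_relabel, BoundedFormula.realize_toFormula, Subsingleton.elim default]
    rfl
  change v 0 ∈ Subtype.val '' {σ : Cond n | P σ.1} ↔ _
  refine Iff.trans ?_ h1.symm
  rw [hφ]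
  constructor
  · rintro ⟨σ, hσ, h⟩
    rw [← h]
    exact ⟨σ.2, hσ⟩
  · rintro ⟨h, h'⟩
    exact ⟨⟨v 0, h⟩, h', rfl⟩

end Definability

/-! ## Generic filters -/

section Generic

variable {M : Type u} [arith.Structure M] {n : M}

theorem Cond.le_refl (σ : Cond n) : σ ≤ σ := fun _ _ h => h

theorem Cond.le_trans {σ τ ρ : Cond n} (h : σ ≤ τ) (h' : τ ≤ ρ) : σ ≤ ρ :=
  fun a b hab => h a b (h' a b hab)

instance : Countable (arith.sum condLang).Symbols := by
  have : ∀ l, Countable (ArithFunc l) := fun l =>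
    ⟨fun f => by cases f; exacts [0, 1, 0, 1, 0, 1, 2], by
      intro f g; cases f <;> cases g <;> simp⟩
  have : ∀ l, Countable (ArithRel l) := fun l =>
    ⟨fun _ => 0, by intro f g; cases f; cases g; simp⟩
  have : ∀ l, Countable (CondRel l) := fun l =>
    ⟨fun _ => 0, by intro f g; cases f; cases g; simp⟩
  exact inferInstanceAs
    (Countable ((Σ l, ArithFunc l ⊕ Empty) ⊕ Σ l, ArithRel l ⊕ CondRel l))

/-- There are countably many formulas with parameters from `M`, and a formula determines the set it
defines. -/
theorem countable_condDefinable [Countable M] : {D : Set (Cond n) | CondDefinable D}.Countable := by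
  let _ := expansion n
  choose! φ hφ using fun (D : Set (Cond n)) (hD : CondDefinable D) => hD
  refine Set.MapsTo.countable_of_injOn (f := φ) (t := Set.univ) (fun _ _ => trivial) ?_
    (Set.to_countable _)
  intro D hD E hE h
  have h1 := hφ D hD
  rw [h, ← hφ E hE] at h1
  refine Set.image_injective.2 Subtype.val_injective (Set.ext fun x => ?_)
  exact Set.ext_iff.1 h1 fun _ => x

/-- The Rasiowa–Sikorski construction: a descending sequence from `σ` enters the definable dense
sets one by one, and its upward closure is the filter. -/
theorem exists_generic [Countable M] (σ : Cond n) : ∃ G : Set (Cond n), IsGeneric G ∧ σ ∈ G := by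
  obtain ⟨D, hD⟩ : ∃ D : ℕ → Set (Cond n), ∀ E, CondDefinable E → ∃ i, D i = E := by
    rcases Set.eq_empty_or_nonempty {D : Set (Cond n) | CondDefinable D} with h | h
    · exact ⟨fun _ => ∅, fun E hE => absurd (h ▸ hE : E ∈ (∅ : Set _)) (Set.notMem_empty _)⟩
    · obtain ⟨D, hD⟩ := countable_condDefinable.exists_eq_range h
      exact ⟨D, fun E hE => (hD ▸ hE : E ∈ Set.range D)⟩
  have step : ∀ (i : ℕ) (τ : Cond n), ∃ ρ, ρ ≤ τ ∧ (IsDenseSet (D i) → ρ ∈ D i) := by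
    intro i τ
    by_cases h : IsDenseSet (D i)
    · obtain ⟨ρ, hρ, hle⟩ := h τ
      exact ⟨ρ, hle, fun _ => hρ⟩
    -- The enumeration also lists sets that are not dense; at these the sequence stays put.
    · exact ⟨τ, τ.le_refl, fun h' => absurd h' h⟩
  choose next hle hmem using step
  let s : ℕ → Cond n := fun i => Nat.rec σ next i
  have anti : ∀ i j, i ≤ j → s j ≤ s i := by
    intro i j hij
    induction hij with
    | refl => exact Cond.le_refl _
    | step _ ih => exact Cond.le_trans (hle _ _) ih
  refine ⟨{τ | ∃ i, s i ≤ τ}, ⟨⟨?_, ?_⟩, ?_⟩, 0, Cond.le_refl σ⟩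
  · rintro τ ⟨i, hi⟩ ρ ⟨j, hj⟩
    exact ⟨s (max i j), Cond.le_trans (anti _ _ (le_max_left i j)) hi,
      Cond.le_trans (anti _ _ (le_max_right i j)) hj⟩
  · rintro τ ⟨i, hi⟩ ρ h
    exact ⟨i, Cond.le_trans hi h⟩
  · intro E hE hdef
    obtain ⟨i, rfl⟩ := hD E hdef
    exact ⟨s (i + 1), ⟨i + 1, Cond.le_refl _⟩, hmem i (s i) hE⟩

variable {G : Set (Cond n)}

theorem IsGeneric.meets_pred (hG : IsGeneric G) {P : M → Prop}
    (hP : DefPred n fun v : Fin 1 → M => P (v 0))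
    (hd : ∀ σ : Cond n, ∃ τ : Cond n, τ ≤ σ ∧ P τ.1) : ∃ σ ∈ G, P σ.1 := by
  obtain ⟨σ, hσ, h⟩ := hG.meets {σ | P σ.1}
    (fun σ => let ⟨τ, hle, h⟩ := hd σ; ⟨τ, h, hle⟩) hP.condDefinable
  exact ⟨σ, hσ, h⟩

theorem IsGeneric.nonempty (hG : IsGeneric G) : ∃ τ, τ ∈ G :=
  let ⟨τ, hτ, _⟩ := hG.meets_pred (P := fun _ => ¬ False) defPred_false.not
    fun τ => ⟨τ, τ.le_refl, id⟩
  ⟨τ, hτ⟩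

theorem defPred_incompatible (σ : Cond n) :
    DefPred n fun v : Fin 1 → M => ∀ δ : Cond n, PairSubset (v 0) δ.1 → ¬ PairSubset σ.1 δ.1 :=
  DefPred.allCond (P := fun (v : Fin 1 → M) δ => PairSubset (v 0) δ → ¬ PairSubset σ.1 δ)
    ((defPred_pairSubset (termFun_var _) (termFun_var _)).imp
      (defPred_pairSubset (termFun_const _) (termFun_var _)).not)

/-- Compatibility supplies a common extension in `ℙ` only. To find one in `G`, genericity is applied
to the conditions that lie below both `σ` and `τ` or are incompatible with one of them; the latter
cannot occur in `G`. -/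
theorem IsGeneric.directed (hG : IsGeneric G) {σ τ : Cond n} (hσ : σ ∈ G) (hτ : τ ∈ G) :
    ∃ δ ∈ G, δ ≤ σ ∧ δ ≤ τ := by
  refine Exists.elim (hG.meets_pred
    (P := fun x => (PairSubset σ.1 x ∧ PairSubset τ.1 x) ∨
      (∀ δ : Cond n, PairSubset x δ.1 → ¬ PairSubset σ.1 δ.1) ∨
      (∀ δ : Cond n, PairSubset x δ.1 → ¬ PairSubset τ.1 δ.1))
    (((defPred_pairSubset (termFun_const _) (termFun_var _)).and
      (defPred_pairSubset (termFun_const _) (termFun_var _))).or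
      ((defPred_incompatible σ).or (defPred_incompatible τ))) ?_) ?_
  rotate_right
  · rintro δ ⟨hδ, h⟩
    rcases h with h | h | h
    · exact ⟨δ, hδ, h⟩
    · obtain ⟨ρ, h1, h2⟩ := hG.filter.compatible δ hδ σ hσ
      exact absurd h2 (h ρ h1)
    · obtain ⟨ρ, h1, h2⟩ := hG.filter.compatible δ hδ τ hτ
      exact absurd h2 (h ρ h1)
  · intro ρ
    by_cases h1 : ∃ δ : Cond n, δ ≤ ρ ∧ δ ≤ σ
    · obtain ⟨δ, h1, h2⟩ := h1
      by_cases h3 : ∃ ε : Cond n, ε ≤ δ ∧ ε ≤ τ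
      · obtain ⟨ε, h3, h4⟩ := h3
        exact ⟨ε, Cond.le_trans h3 h1, .inl ⟨Cond.le_trans h3 h2, h4⟩⟩
      · exact ⟨δ, h1, .inr (.inr fun ε h5 h6 => h3 ⟨ε, h5, h6⟩)⟩
    · exact ⟨ρ, ρ.le_refl, .inr (.inl fun δ h2 h3 => h1 ⟨δ, h2, h3⟩)⟩

/-- Density below `σ` becomes density once the conditions incompatible with `σ` are added, and none
of these lies in `G`. -/
theorem IsGeneric.meets_below (hG : IsGeneric G) {σ : Cond n} (hσ : σ ∈ G) {P : M → Prop}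
    (hP : DefPred n fun v : Fin 1 → M => P (v 0))
    (hd : ∀ τ : Cond n, τ ≤ σ → ∃ ρ : Cond n, ρ ≤ τ ∧ P ρ.1) : ∃ τ ∈ G, P τ.1 := by
  refine Exists.elim (hG.meets_pred
    (P := fun x => P x ∨ ∀ δ : Cond n, PairSubset x δ.1 → ¬ PairSubset σ.1 δ.1)
    (hP.or (defPred_incompatible σ)) ?_) ?_
  rotate_right
  · rintro δ ⟨hδ, h⟩
    rcases h with h | h
    · exact ⟨δ, hδ, h⟩
    · obtain ⟨ρ, h1, h2⟩ := hG.filter.compatible δ hδ σ hσ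
      exact absurd h2 (h ρ h1)
  · intro ρ
    by_cases h1 : ∃ δ : Cond n, δ ≤ ρ ∧ δ ≤ σ
    · obtain ⟨δ, h1, h2⟩ := h1
      obtain ⟨ε, h3, h4⟩ := hd δ h2
      exact ⟨ε, Cond.le_trans h3 h1, .inl h4⟩
    · exact ⟨ρ, ρ.le_refl, .inr fun δ h2 h3 => h1 ⟨δ, h2, h3⟩⟩

end Generic

/-! ## The truth lemma -/

section Truth

variable {M : Type u} [arith.Structure M] [M ⊨ arith.completeTheory ℕ] {n : M}

/-- A statement `T` about a set `G` of conditions and a tuple from the cut is governed by a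
definable monotone predicate of conditions: for generic `G`, it holds when some condition in `G`
satisfies the predicate. -/
def Governed (hn : Nonstandard n) {k : ℕ} (T : Set (Cond n) → (Fin k → cut hn) → Prop) : Prop :=
  ∃ P : M → (Fin k → M) → Prop,
    -- Definability is required under all substitutions of term functions, so that it survives the
    -- change of variables at quantifiers.
    (∀ (m : ℕ) (s : (Fin m → M) → M) (w : Fin k → (Fin m → M) → M), TermFun n s →
      (∀ i, TermFun n (w i)) → DefPred n fun x => P (s x) fun i => w i x) ∧
    (∀ σ τ : Cond n, τ ≤ σ → ∀ v, P σ.1 v → P τ.1 v) ∧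
    ∀ G, IsGeneric G → ∀ v : Fin k → cut hn, T G v ↔ ∃ σ ∈ G, P σ.1 fun i => v i

variable {hn : Nonstandard n} {k : ℕ}

theorem Governed.of_absolute {P : (Fin k → M) → Prop}
    (hP : ∀ (m : ℕ) (w : Fin k → (Fin m → M) → M), (∀ i, TermFun n (w i)) →
      DefPred n fun x => P fun i => w i x) :
    Governed hn fun _ v => P fun i => v i :=
  ⟨fun _ v => P v, fun m _ w _ hw => hP m w hw, fun _ _ _ _ h => h, fun _ hG _ =>
    ⟨fun h => let ⟨σ, hσ⟩ := hG.nonempty; ⟨σ, hσ, h⟩, fun ⟨_, _, h⟩ => h⟩⟩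

/-- The predicate for the implication says: below every extension satisfying `P₁`, the conditions
satisfying `P₂` are dense. -/
theorem Governed.imp {T₁ T₂ : Set (Cond n) → (Fin k → cut hn) → Prop} (h₁ : Governed hn T₁)
    (h₂ : Governed hn T₂) : Governed hn fun G v => T₁ G v → T₂ G v := by
  obtain ⟨P₁, hd₁, hm₁, ht₁⟩ := h₁
  obtain ⟨P₂, hd₂, hm₂, ht₂⟩ := h₂
  have hd : ∀ (m : ℕ) (s : (Fin m → M) → M) (w : Fin k → (Fin m → M) → M), TermFun n s →
      (∀ i, TermFun n (w i)) → DefPred n fun x => ∀ τ : Cond n, PairSubset (s x) τ.1 →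
        P₁ τ.1 (fun i => w i x) → ∃ ρ : Cond n, PairSubset τ.1 ρ.1 ∧ P₂ ρ.1 fun i => w i x := by
    intro m s w hs hw
    refine DefPred.allCond (P := fun x τ => PairSubset (s x) τ →
      P₁ τ (fun i => w i x) → ∃ ρ : Cond n, PairSubset τ ρ.1 ∧ P₂ ρ.1 fun i => w i x) ?_
    refine (defPred_pairSubset hs.weaken (termFun_var _)).imp
      ((hd₁ _ _ _ (termFun_var _) fun i => (hw i).weaken).imp ?_)
    refine DefPred.exCond (P := fun (x : Fin (m + 1) → M) ρ => PairSubset (x (Fin.last m)) ρ ∧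
      P₂ ρ fun i => w i fun j => x j.castSucc) ?_
    exact (defPred_pairSubset (termFun_var (Fin.last m)).weaken (termFun_var _)).and
      (hd₂ _ _ _ (termFun_var _) fun i => (hw i).weaken.weaken)
  refine ⟨fun s v => ∀ τ : Cond n, PairSubset s τ.1 → P₁ τ.1 v →
    ∃ ρ : Cond n, PairSubset τ.1 ρ.1 ∧ P₂ ρ.1 v, hd, fun σ τ h v H δ hδ => H δ (Cond.le_trans (σ := δ) hδ h), ?_⟩
  intro G hG v
  constructor
  · intro H
    -- A condition without the new predicate has an extension that satisfies `P₁` and has no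
    -- extension satisfying `P₂`. Such an extension in `G` would make `T₁` true and `T₂` false.
    refine Exists.elim (hG.meets_pred
      (P := fun x => (∀ τ : Cond n, PairSubset x τ.1 →
        P₁ τ.1 (fun i => v i) → ∃ ρ : Cond n, PairSubset τ.1 ρ.1 ∧ P₂ ρ.1 fun i => v i) ∨
        (P₁ x (fun i => v i) ∧ ∀ ρ : Cond n, PairSubset x ρ.1 → ¬ P₂ ρ.1 fun i => v i))
      ((hd 1 _ _ (termFun_var _) fun i => termFun_const _).or
        ((hd₁ 1 _ _ (termFun_var _) fun i => termFun_const _).and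
          (DefPred.allCond (P := fun (x : Fin 1 → M) ρ => PairSubset (x 0) ρ →
            ¬ P₂ ρ fun i => v i) ((defPred_pairSubset (termFun_var _) (termFun_var _)).imp
              (hd₂ _ _ _ (termFun_var _) fun i => termFun_const _).not)))) ?_) ?_
    rotate_right
    · rintro σ ⟨hσ, h | ⟨h, h'⟩⟩
      · exact ⟨σ, hσ, h⟩
      · obtain ⟨τ, hτ, h2⟩ := (ht₂ G hG v).1 (H ((ht₁ G hG v).2 ⟨σ, hσ, h⟩))
        obtain ⟨δ, -, h3, h4⟩ := hG.directed hσ hτ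
        exact absurd (hm₂ τ δ h4 _ h2) (h' δ h3)
    · intro σ
      by_cases h : ∀ τ : Cond n, PairSubset σ.1 τ.1 →
        P₁ τ.1 (fun i => v i) → ∃ ρ : Cond n, PairSubset τ.1 ρ.1 ∧ P₂ ρ.1 fun i => v i
      · exact ⟨σ, σ.le_refl, .inl h⟩
      · push Not at h
        obtain ⟨τ, h1, h2, h3⟩ := h
        exact ⟨τ, h1, .inr ⟨h2, h3⟩⟩
  · rintro ⟨σ, hσ, H⟩ h1
    obtain ⟨τ, hτ, h1⟩ := (ht₁ G hG v).1 h1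
    obtain ⟨δ, hδ, h3, h4⟩ := hG.directed hσ hτ
    refine (ht₂ G hG v).2 (hG.meets_below hδ (P := fun x => P₂ x fun i => v i)
      (hd₂ _ _ _ (termFun_var _) fun i => termFun_const _) fun ρ hρ => ?_)
    exact H ρ (Cond.le_trans hρ h3) (hm₁ τ ρ (Cond.le_trans hρ h4) _ h1)

/-- The predicate for `∀` says that for each `a` in the cut the conditions satisfying `P` at `a` are
dense below. Its definability uses that of the cut. -/
theorem Governed.all {T : Set (Cond n) → (Fin (k + 1) → cut hn) → Prop} (h : Governed hn T) :
    Governed hn fun G v => ∀ a, T G (Fin.snoc v a) := by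
  obtain ⟨P, hd, hm, ht⟩ := h
  have hsnoc : ∀ (v : Fin k → cut hn) (a : cut hn),
      (fun i => ((Fin.snoc v a : Fin (k + 1) → cut hn) i : M)) =
        Fin.snoc (fun i => (v i : M)) (a : M) := by
    intro v a
    funext i
    refine Fin.lastCases ?_ (fun i => ?_) i <;> simp
  have hd' : ∀ (m : ℕ) (s : (Fin m → M) → M) (w : Fin k → (Fin m → M) → M)
      (a : (Fin m → M) → M), TermFun n s → (∀ i, TermFun n (w i)) → TermFun n a →
      DefPred n fun x => P (s x) (Fin.snoc (fun i => w i x) (a x)) := by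
    intro m s w a hs hw ha
    refine (hd m s (Fin.snoc (α := fun _ => (Fin m → M) → M) w a) hs fun i => ?_).congr fun x => ?_
    · refine Fin.lastCases ?_ (fun i => ?_) i
      · simpa using ha
      · simpa using hw i
    · refine iff_of_eq (congrArg (P (s x)) (funext fun i => ?_))
      refine Fin.lastCases ?_ (fun i => ?_) i <;> simp
  have hdall : ∀ (m : ℕ) (s : (Fin m → M) → M) (w : Fin k → (Fin m → M) → M), TermFun n s →
      (∀ i, TermFun n (w i)) → DefPred n fun x => ∀ a : cut hn, ∀ τ : Cond n,
        PairSubset (s x) τ.1 → ∃ ρ : Cond n, PairSubset τ.1 ρ.1 ∧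
          P ρ.1 (Fin.snoc (fun i => w i x) (a : M)) := by
    intro m s w hs hw
    refine DefPred.allCut hn (P := fun x a => ∀ τ : Cond n,
        PairSubset (s x) τ.1 → ∃ ρ : Cond n, PairSubset τ.1 ρ.1 ∧
          P ρ.1 (Fin.snoc (fun i => w i x) a)) ?_
    refine DefPred.allCond (P := fun (x : Fin (m + 1) → M) τ =>
        PairSubset (s fun j => x j.castSucc) τ → ∃ ρ : Cond n, PairSubset τ ρ.1 ∧
          P ρ.1 (Fin.snoc (fun i => w i fun j => x j.castSucc) (x (Fin.last m)))) ?_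
    refine (defPred_pairSubset hs.weaken.weaken (termFun_var _)).imp ?_
    refine DefPred.exCond (P := fun (x : Fin (m + 2) → M) ρ => PairSubset (x (Fin.last (m + 1))) ρ ∧
      P ρ (Fin.snoc (fun i => w i fun j => x j.castSucc.castSucc) (x (Fin.last m).castSucc))) ?_
    exact (defPred_pairSubset (termFun_var (Fin.last (m + 1))).weaken (termFun_var _)).and
      (hd' _ _ _ _ (termFun_var _) (fun i => (hw i).weaken.weaken.weaken)
        (termFun_var (Fin.last m)).weaken.weaken)
  refine ⟨fun s v => ∀ a : cut hn, ∀ τ : Cond n, PairSubset s τ.1 →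
    ∃ ρ : Cond n, PairSubset τ.1 ρ.1 ∧ P ρ.1 (Fin.snoc v (a : M)), hdall, fun σ τ h v H a δ hδ => H a δ (Cond.le_trans (σ := δ) hδ h), ?_⟩
  intro G hG v
  constructor
  · intro H
    -- A condition without the new predicate has an extension that rules out `P` at some `a` for
    -- good. Such an extension in `G` would refute the instance at `a`.
    refine Exists.elim (hG.meets_pred
      (P := fun x => (∀ a : cut hn, ∀ τ : Cond n, PairSubset x τ.1 → ∃ ρ : Cond n,
          PairSubset τ.1 ρ.1 ∧ P ρ.1 (Fin.snoc (fun i => (v i : M)) (a : M))) ∨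
        ∃ a : cut hn, ∀ ρ : Cond n, PairSubset x ρ.1 →
          ¬ P ρ.1 (Fin.snoc (fun i => (v i : M)) (a : M))) ?_ ?_) ?_
    rotate_right
    · rintro σ ⟨hσ, h | ⟨a, h⟩⟩
      · exact ⟨σ, hσ, h⟩
      · obtain ⟨τ, hτ, h2⟩ := (ht G hG _).1 (H a)
        obtain ⟨δ, -, h3, h4⟩ := hG.directed hσ hτ
        rw [hsnoc] at h2
        exact absurd (hm τ δ h4 _ h2) (h δ h3)
    · refine (hdall 1 _ _ (termFun_var _) fun i => termFun_const _).or ?_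
      refine DefPred.congr (DefPred.not (DefPred.allCut hn (P := fun (x : Fin 1 → M) a =>
        ¬ ∀ ρ : Cond n, PairSubset (x 0) ρ.1 → ¬ P ρ.1 (Fin.snoc (fun i => (v i : M)) a)) ?_))
        fun x => by rw [not_forall_not]
      refine DefPred.not (DefPred.allCond (P := fun (x : Fin 2 → M) ρ =>
        PairSubset (x 0) ρ → ¬ P ρ (Fin.snoc (fun i => (v i : M)) (x 1))) ?_)
      exact (defPred_pairSubset (termFun_var (0 : Fin 2)).weaken (termFun_var _)).imp
        (hd' _ _ _ _ (termFun_var _) (fun i => termFun_const _)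
          (termFun_var (1 : Fin 2)).weaken).not
    · intro σ
      by_cases h : ∀ a : cut hn, ∀ τ : Cond n, PairSubset σ.1 τ.1 → ∃ ρ : Cond n,
          PairSubset τ.1 ρ.1 ∧ P ρ.1 (Fin.snoc (fun i => (v i : M)) (a : M))
      · exact ⟨σ, σ.le_refl, .inl h⟩
      · push Not at h
        obtain ⟨a, τ, h1, h2⟩ := h
        exact ⟨τ, h1, .inr ⟨a, h2⟩⟩
  · rintro ⟨σ, hσ, H⟩ a
    refine (ht G hG _).2 ?_
    rw [hsnoc]
    exact hG.meets_below hσ (P := fun x => P x (Fin.snoc (fun i => (v i : M)) (a : M)))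
      (hd' _ _ _ _ (termFun_var _) (fun i => termFun_const _) (termFun_const _)) (H a)

/-- The value of a term in `(𝕀, R_G)` does not depend on `G` and is definable. -/
theorem exists_termFun (t : arithR[[cut hn]].Term (Empty ⊕ Fin k)) :
    ∃ T : (Fin k → M) → M,
      (∀ (m : ℕ) (w : Fin k → (Fin m → M) → M), (∀ i, TermFun n (w i)) →
        TermFun n fun x => T fun i => w i x) ∧
      ∀ (G : Set (Cond n)) (v : Fin k → cut hn),
        letI := genericStructure hn G
        ((t.realize (Sum.elim default v) : cut hn) : M) = T fun i => v i := by
  induction t with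
  | var i =>
    rcases i with i | i
    · exact i.elim
    · exact ⟨fun v => v i, fun m w hw => hw i, fun _ _ => rfl⟩
  | @func l f ts ih =>
    choose T hT hv using ih
    rcases f with (F | F) | c
    · refine ⟨fun v => funMap F fun i => T i v,
        fun m w hw => termFun_funMap F fun i => hT i m w hw, fun G v => ?_⟩
      simp only [← fun i => hv i G v]
      rfl
    · exact F.elim
    · cases l with
      -- The only remaining symbols are the constants for parameters, which denote themselves.
      | zero => exact ⟨fun _ => (show cut hn from c).1, fun m w hw => termFun_const _, fun _ _ => rfl⟩
      | succ l => cases l <;> exact c.elim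

/-- The truth lemma, in terms of definable predicates. -/
theorem governed_realize (φ : arithR[[cut hn]].BoundedFormula Empty k) :
    Governed hn fun G v => letI := genericStructure hn G; φ.Realize default v := by
  induction φ with
  | falsum => exact Governed.of_absolute (P := fun _ => False) fun _ _ _ => defPred_false
  | equal t u =>
    obtain ⟨T, hT, ht⟩ := exists_termFun t
    obtain ⟨U, hU, hu⟩ := exists_termFun u
    have h := Governed.of_absolute (hn := hn) (P := fun v => T v = U v)
      fun m w hw => defPred_eq (hT m w hw) (hU m w hw)
    convert h using 3 with G v
    rw [← ht G v, ← hu G v, ← Subtype.ext_iff]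
    rfl
  | @rel k l r ts =>
    choose T hT hv using fun i => exists_termFun (ts i)
    rcases r with (r | r) | r
    · have h := Governed.of_absolute (hn := hn) (P := fun v => RelMap r fun i => T i v)
        fun m w hw => defPred_relMap r fun i => hT i m w hw
      convert h using 3 with G v
      simp only [← fun i => hv i G v]
      rfl
    · cases r
      -- For `R` the predicate is membership of the pair in the condition, since `R_G` is the union
      -- of `G`.
      refine ⟨fun s v => mmem (mpair (T 0 v) (T 1 v)) s,
        fun m s w hs hw => defPred_mem ((hT 0 m w hw).pair (hT 1 m w hw)) hs,
        fun σ τ h v hσ => h _ _ hσ, fun G _ v => ?_⟩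
      simp only [← fun i => hv i G v]
      rfl
    · exact r.elim
  | imp _ _ ih₁ ih₂ => exact ih₁.imp ih₂
  | all _ ih => exact ih.all

end Truth

/-! ## Properties of forcing -/

section Forcing

variable {M : Type u} [arith.Structure M] [M ⊨ arith.completeTheory ℕ] {n : M}

/-- The governing predicate does not mention `G`, so a condition satisfying it makes `φ` true in
every generic model to which it belongs. -/
theorem exists_forces_of_holds (hn : Nonstandard n) {G : Set (Cond n)} (hG : IsGeneric G)
    {φ : arithR[[cut hn]].Sentence} (h : Holds hn G φ) : ∃ σ ∈ G, Forces hn σ φ := by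
  obtain ⟨P, -, -, ht⟩ := governed_realize φ
  have key : ∀ G, IsGeneric G → (Holds hn G φ ↔ ∃ σ ∈ G, P σ.1 fun i => (default : Fin 0 → M) i) :=
    fun G hG => by
    rw [Subsingleton.elim (fun i => (default : Fin 0 → M) i)
      fun i => ((default : Fin 0 → cut hn) i : M), ← ht G hG]
    rfl
  obtain ⟨σ, hσ, hP⟩ := (key G hG).1 h
  exact ⟨σ, hσ, fun G' hG' hσ' => (key G' hG').2 ⟨σ, hσ', hP⟩⟩

/-- A true sentence is forced by a condition in `G` below a given one. -/
theorem exists_forces_below_of_holds (hn : Nonstandard n) {G : Set (Cond n)} (hG : IsGeneric G)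
    {σ : Cond n} (hσ : σ ∈ G) {φ : arithR[[cut hn]].Sentence} (h : Holds hn G φ) :
    ∃ τ, τ ≤ σ ∧ Forces hn τ φ := by
  obtain ⟨ρ, hρ, hf⟩ := exists_forces_of_holds hn hG h
  obtain ⟨δ, -, h1, h2⟩ := hG.directed hσ hρ
  exact ⟨δ, h1, fun G' hG' hδ => hf G' hG' (hG'.filter.upward δ hδ ρ h2)⟩

theorem Forces.mono {hn : Nonstandard n} {σ τ : Cond n} {φ : arithR[[cut hn]].Sentence}
    (h : Forces hn σ φ) (hle : τ ≤ σ) : Forces hn τ φ :=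
  fun G hG hτ => h G hG (hG.filter.upward τ hτ σ hle)

theorem holds_not {hn : Nonstandard n} {G : Set (Cond n)} {φ : arithR[[cut hn]].Sentence} :
    Holds hn G (∼φ) ↔ ¬ Holds hn G φ := Iff.rfl

/-- A sentence is forced once no extension forces its negation. -/
theorem forces_of_forall_not_forces_not (hn : Nonstandard n) {σ : Cond n}
    {φ : arithR[[cut hn]].Sentence} (h : ∀ τ : Cond n, τ ≤ σ → ¬ Forces hn τ (∼φ)) :
    Forces hn σ φ := by
  intro G hG hσ
  by_contra hφ
  obtain ⟨τ, hτ, hf⟩ := exists_forces_below_of_holds hn hG hσ (holds_not.2 hφ)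
  exact h τ hτ hf

theorem holds_atomR (hn : Nonstandard n) (G : Set (Cond n)) (a b : cut hn) :
    Holds hn G (atomR a b) ↔ genericRel G (a : M) (b : M) := Iff.rfl

theorem holds_instantiate (hn : Nonstandard n) (G : Set (Cond n)) {k : ℕ}
    (φ : arithR[[cut hn]].BoundedFormula Empty k) (a : Fin k → cut hn) :
    Holds hn G (instantiate φ a) ↔ letI := genericStructure hn G; φ.Realize default a := by
  let _ := genericStructure hn G
  change BoundedFormula.Realize (instantiate φ a) default default ↔ _
  rw [instantiate, BoundedFormula.realize_subst]
  refine (BoundedFormula.realize_toFormula φ _).trans ?_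
  refine iff_of_eq ?_
  congr 1
  exact Subsingleton.elim _ _

theorem holds_inf {hn : Nonstandard n} {G : Set (Cond n)} {φ θ : arithR[[cut hn]].Sentence} :
    Holds hn G (φ ⊓ θ) ↔ Holds hn G φ ∧ Holds hn G θ := by
  let _ := genericStructure hn G
  exact BoundedFormula.realize_inf

theorem holds_sup {hn : Nonstandard n} {G : Set (Cond n)} {φ θ : arithR[[cut hn]].Sentence} :
    Holds hn G (φ ⊔ θ) ↔ Holds hn G φ ∨ Holds hn G θ := by
  let _ := genericStructure hn G
  exact BoundedFormula.realize_sup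

theorem holds_all {hn : Nonstandard n} {G : Set (Cond n)}
    {φ : arithR[[cut hn]].BoundedFormula Empty 1} :
    Holds hn G (∀' φ) ↔ ∀ a, Holds hn G (instantiate φ ![a]) := by
  simp only [holds_instantiate]
  let _ := genericStructure hn G
  refine BoundedFormula.realize_all.trans (forall_congr' fun a => iff_of_eq ?_)
  congr 1
  ext i
  fin_cases i
  rfl

theorem holds_exs {hn : Nonstandard n} {G : Set (Cond n)} {k : ℕ}
    {φ : arithR[[cut hn]].BoundedFormula Empty k} :
    Holds hn G φ.exs ↔ ∃ a, Holds hn G (instantiate φ a) := by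
  simp only [holds_instantiate]
  let _ := genericStructure hn G
  exact BoundedFormula.realize_exs

theorem le_single_iff {σ : Cond n} {a b : M} (ha : mlt a (madd n mone)) (hb : mlt b n) :
    σ ≤ single a b ha hb ↔ σ.Has a b := by
  constructor
  · exact fun h => h a b ((mmem_single a b ha hb _).2 rfl)
  · intro h x y hxy
    obtain ⟨rfl, rfl⟩ := mpair_inj ((mmem_single a b ha hb _).1 hxy)
    exact h

/-- A condition not containing `(a, b)` has an extension incompatible with `(a, b)`. -/
theorem exists_incompatible_single (hn : Nonstandard n) {σ : Cond n} {a b : M}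
    (ha : mlt a (madd n mone)) (hb : mlt b n) (h : ¬ σ.Has a b) :
    ∃ τ : Cond n, τ ≤ σ ∧ Incompatible (single a b ha hb) τ := by
  -- It suffices that `τ` send some `x ≠ a` to `b`. Either `σ` already does so, or `b` is outside
  -- its range and a point off its domain can be sent there.
  obtain ⟨τ, hτ, x, hxa, hx⟩ : ∃ τ : Cond n, τ ≤ σ ∧ ∃ x, x ≠ a ∧ τ.Has x b := by
    by_cases hr : ∃ x, σ.Has x b
    · obtain ⟨x, hx⟩ := hr
      exact ⟨σ, σ.le_refl, x, fun hxa => h (hxa ▸ hx), hx⟩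
    · obtain ⟨x, hx, hxa, hdom⟩ := exists_notMem_domain hn σ a
      obtain ⟨τ, hτ, hxb⟩ := exists_extension hn σ hx hb hdom fun y hy => hr ⟨y, hy⟩
      exact ⟨τ, hτ, x, hxa, hxb⟩
  refine ⟨τ, hτ, fun ⟨δ, h1, h2⟩ => hxa ?_⟩
  exact δ.2.injective _ _ _ (h2 _ _ hx) ((le_single_iff ha hb).1 h1)

variable [Countable M]

theorem forces_not_iff (hn : Nonstandard n) {σ : Cond n} {φ : arithR[[cut hn]].Sentence} :
    Forces hn σ (∼φ) ↔ ∀ τ : Cond n, τ ≤ σ → ¬ Forces hn τ φ := by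
  constructor
  · intro h τ hτ hf
    obtain ⟨G, hG, hmem⟩ := exists_generic τ
    exact h.mono hτ G hG hmem (hf G hG hmem)
  · intro h G hG hσ hφ
    obtain ⟨τ, hτ, hf⟩ := exists_forces_below_of_holds hn hG hσ hφ
    exact h τ hτ hf

/-- If, in all generic models, `φ` holds when one of a family of sentences does, then `φ` is
forced exactly when the conditions forcing a member of the family are dense. -/
theorem forces_iff_of_holds_iff_exists (hn : Nonstandard n) {σ : Cond n} {ι : Type*}
    {φ : arithR[[cut hn]].Sentence} {ψ : ι → arithR[[cut hn]].Sentence}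
    (h : ∀ G, Holds hn G φ ↔ ∃ i, Holds hn G (ψ i)) :
    Forces hn σ φ ↔
      ∀ τ : Cond n, τ ≤ σ → ∃ ρ : Cond n, ρ ≤ τ ∧ ∃ i, Forces hn ρ (ψ i) := by
  constructor
  · intro hf τ hτ
    obtain ⟨G, hG, hmem⟩ := exists_generic τ
    obtain ⟨i, hi⟩ := (h G).1 (hf.mono hτ G hG hmem)
    obtain ⟨ρ, hρ, hf'⟩ := exists_forces_below_of_holds hn hG hmem hi
    exact ⟨ρ, hρ, i, hf'⟩
  · intro hd
    -- If some `τ ≤ σ` forced `¬φ`, a generic filter through an extension of `τ` forcing some `ψ i`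
    -- would make `φ` both true and false.
    refine forces_of_forall_not_forces_not hn fun τ hτ hnot => ?_
    obtain ⟨ρ, hρ, i, hi⟩ := hd τ hτ
    obtain ⟨G, hG, hmem⟩ := exists_generic ρ
    exact hnot.mono hρ G hG hmem ((h G).2 ⟨i, hi G hG hmem⟩)

theorem forces_not_atomR_iff (hn : Nonstandard n) (σ : Cond n) {a b : M}
    (ha : mlt a (madd n mone)) (hb : mlt b n) :
    Forces hn σ
        (∼(atomR ⟨a, mem_cutSet_of_lt hn ha⟩ ⟨b, mem_cutSet_of_lt hn (lt_succ_of_lt hb)⟩)) ↔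
      Incompatible (single a b ha hb) σ := by
  constructor
  · rintro h ⟨δ, h1, h2⟩
    obtain ⟨G, hG, hmem⟩ := exists_generic δ
    refine holds_not.1 (h.mono h2 G hG hmem) ?_
    exact (holds_atomR hn G _ _).2 ⟨δ, hmem, (le_single_iff ha hb).1 h1⟩
  · refine fun h G hG hσ => holds_not.2 fun hR => ?_
    obtain ⟨τ, hτ, hab⟩ := (holds_atomR hn G _ _).1 hR
    obtain ⟨δ, -, h1, h2⟩ := hG.directed hσ hτ
    exact h ⟨δ, (le_single_iff ha hb).2 (h2 _ _ hab), h1⟩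

/-- If the pair is missing from `σ`, an extension incompatible with it forces `¬R(a, b)`, which
contradicts `σ ⊩ R(a, b)` in a generic model. -/
theorem forces_atomR_iff (hn : Nonstandard n) (σ : Cond n) {a b : M}
    (ha : mlt a (madd n mone)) (hb : mlt b n) :
    Forces hn σ (atomR ⟨a, mem_cutSet_of_lt hn ha⟩ ⟨b, mem_cutSet_of_lt hn (lt_succ_of_lt hb)⟩) ↔
      σ ≤ single a b ha hb := by
  rw [le_single_iff]
  constructor
  · intro h
    by_contra hab
    obtain ⟨τ, hτ, hinc⟩ := exists_incompatible_single hn ha hb hab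
    obtain ⟨G, hG, hmem⟩ := exists_generic τ
    exact (forces_not_atomR_iff hn τ ha hb).2 hinc G hG hmem (h.mono hτ G hG hmem)
  · exact fun h G _ hσ => (holds_atomR hn G _ _).2 ⟨σ, hσ, h⟩

end Forcing

end BoundedArith

theorem theorem3p7 {M : Type u} [Countable M] [arith.Structure M] [M ⊨ arith.completeTheory ℕ]
    (n : M) (hn : Nonstandard n) (σ : Cond n) :
    -- the clause for `R(a, b)`
    (∀ (a b : M) (ha : mlt a (madd n mone)) (hb : mlt b n),
      Forces hn σ (atomR ⟨a, mem_cutSet_of_lt hn ha⟩ ⟨b, mem_cutSet_of_lt hn (lt_succ_of_lt hb)⟩) ↔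
        σ ≤ single a b ha hb) ∧
    -- the clause for `¬ R(a, b)`
    (∀ (a b : M) (ha : mlt a (madd n mone)) (hb : mlt b n),
      Forces hn σ
        (∼(atomR ⟨a, mem_cutSet_of_lt hn ha⟩ ⟨b, mem_cutSet_of_lt hn (lt_succ_of_lt hb)⟩)) ↔
        Incompatible (single a b ha hb) σ) ∧
    -- conjunction
    (∀ φ θ : arithR[[cut hn]].Sentence,
      Forces hn σ (φ ⊓ θ) ↔ Forces hn σ φ ∧ Forces hn σ θ) ∧
    -- universal quantifier
    (∀ φ : arithR[[cut hn]].BoundedFormula Empty 1,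
      Forces hn σ (∀' φ) ↔ ∀ a : cut hn, Forces hn σ (instantiate φ ![a])) ∧
    -- negation
    (∀ φ : arithR[[cut hn]].Sentence, SharplyBounded φ →
      (Forces hn σ (∼φ) ↔ ∀ τ : Cond n, τ ≤ σ → ¬ Forces hn τ φ)) ∧
    -- disjunction
    (∀ φ θ : arithR[[cut hn]].Sentence, SharplyBounded φ → SharplyBounded θ →
      (Forces hn σ (φ ⊔ θ) ↔
        ∀ τ : Cond n, τ ≤ σ → ∃ ρ : Cond n, ρ ≤ τ ∧ (Forces hn ρ φ ∨ Forces hn ρ θ))) ∧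
    -- existential quantifiers
    (∀ (k : ℕ) (φ : arithR[[cut hn]].BoundedFormula Empty k), SharplyBounded φ →
      (Forces hn σ φ.exs ↔
        ∀ τ : Cond n, τ ≤ σ → ∃ ρ : Cond n, ρ ≤ τ ∧
          ∃ a : Fin k → cut hn, Forces hn ρ (instantiate φ a))) := by
  refine ⟨fun a b ha hb => forces_atomR_iff hn σ ha hb,
    fun a b ha hb => forces_not_atomR_iff hn σ ha hb, fun φ θ => ?_, fun φ => ?_,
    fun φ _ => forces_not_iff hn, fun φ θ _ _ => ?_,
    fun k φ _ => forces_iff_of_holds_iff_exists hn fun G => holds_exs⟩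
  · simp only [Forces, holds_inf]
    exact ⟨fun h => ⟨fun G hG hσ => (h G hG hσ).1, fun G hG hσ => (h G hG hσ).2⟩,
      fun h G hG hσ => ⟨h.1 G hG hσ, h.2 G hG hσ⟩⟩
  · simp only [Forces, holds_all]
    exact ⟨fun h a G hG hσ => h G hG hσ a, fun h G hG hσ a => h a G hG hσ⟩
  -- A disjunction is treated as an existential statement over the two-element index set `Bool`.
  · have h := forces_iff_of_holds_iff_exists hn (σ := σ) (φ := φ ⊔ θ)
      (ψ := fun i : Bool => if i then φ else θ) fun G => by
        rw [holds_sup, Bool.exists_bool, or_comm]; rfl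
    rw [h]
    simp only [Bool.exists_bool, or_comm]
    rfl
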